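/- For a finite symmetric generating set $S$ of a group $G$ (so $S=S^{-1}$), the simple random walk on $G$ with generating set $S$ has independent steps uniformly distributed on $S$; its drift is $L_n=\sum_{g\in G}\mu^{*n}(g)\,l_S(g)$, where $\mu$ is the uniform measure on $S$, $\mu^{*n}$ its $n$-fold convolution and $l_S$ the word length with respect to $S$. We write $u_n\asymp v_n$ if $c\,v_n\le u_n\le C\,v_n$ for some constants $c,C>0$ and all sufficiently large $n$. Let $A$ be a group generated by $a_1,\dots,a_k$ ($k\ge 1$), and let $\alpha\in\mathbb R$. Suppose that the simple random walk on $A$ with generating set $\{a_1^{\pm1},\dots,a_k^{\pm1}\}$ has drift $L_n^A\asymp n^\alpha$. Let $B=\mathbb Z\wr A$ be the wreath product, i.e. the group of all pairs $(i,f)$ with $i\in\mathbb Z$ and $f:\mathbb Z\to A$ equal to the identity at all but finitely many places, with the multiplication $(i,f)(j,h)=(i+j,\,f\cdot h^{i})$, $h^{i}(x)=h(x-i)$. Let $\delta=(1,e)$ (where $e$ is the constant identity function), and for $x\in A$ let $x^e=(0,\tilde x)$, where $\tilde x(0)=x$ and $\tilde x(y)$ is the identity for $y\ne 0$. Let $T$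 be the finite set that consists of the elements $(a_i^e)^p\,\delta\,(a_j^e)^q$, $1\le i,j\le k$, $p,q\in\{0,1,-1\}$, and their inverses. Then $T$ is a symmetric generating set of $B$, and the simple random walk on $B$ with generating set $T$ has drift $L_n^B\asymp n^{(\alpha+1)/2}$. In particular, some simple random walk on $B$ has this drift. -/

import Mathlib

/-- The length of `g` with respect to the generating set `U`: the least length of a word in the
elements of `U` and their inverses that represents `g`. -/
noncomputable def wordLength {G : Type*} [Group G] (U : Set G) (g : G) : ℕ :=
  sInf {m : ℕ | ∃ w : List G, w.length = m ∧ (∀ x ∈ w, x ∈ U ∨ x⁻¹ ∈ U) ∧ w.prod = g}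

/-- The `n`-fold convolution `μ^{*n}` of a probability mass function on a group: the law of
`s₁ * s₂ * ⋯ * sₙ` for independent `sᵢ` with law `μ`. -/
noncomputable def convPow {G : Type*} [Group G] (μ : PMF G) : ℕ → PMF G
  | 0 => PMF.pure 1
  | n + 1 => (convPow μ n).bind fun g => μ.bind fun s => PMF.pure (g * s)

/-- The drift `Lₙ`: the mean of the word length under `μ^{*n}`, for the simple random walk, whose
step distribution `μ` is uniform on the finite set `S`, and the word length given by `S`. Only
finitely many terms of the sum are nonzero. -/
noncomputable def simpleDrift {G : Type*} [Group G] (S : Finset G) (hS : S.Nonempty) (n : ℕ) : ℝ :=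
  ∑' g : G, (convPow (PMF.uniformOfFinset S hS) n g).toReal * (wordLength (S : Set G) g : ℝ)

/-- `S` is a finite symmetric generating set of `G`. -/
def IsSymmGenerating {G : Type*} [Group G] (S : Finset G) : Prop :=
  (∀ g ∈ S, g⁻¹ ∈ S) ∧ Subgroup.closure (S : Set G) = ⊤

/-- The set of the elements `a₁, …, a_k` and their inverses. -/
noncomputable def withInverses {G : Type*} [Group G] {k : ℕ} (a : Fin k → G) : Finset G :=
  open Classical in Finset.univ.image a ∪ Finset.univ.image (fun j => (a j)⁻¹)

theorem withInverses_nonempty {G : Type*} [Group G] {k : ℕ} [NeZero k] (a : Fin k → G) :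
    (withInverses a).Nonempty := by
  classical
  exact ⟨a 0, by simp [withInverses]⟩

/-- The direct sum `∑_ℤ A`: functions `ℤ → A` equal to the identity at all but finitely many
places, with pointwise multiplication. -/
def FinLamps (A : Type*) [Group A] : Subgroup (ℤ → A) where
  carrier := {f | (Function.mulSupport f).Finite}
  one_mem' := by simp
  mul_mem' {f g} hf hg := (hf.union hg).subset (Function.mulSupport_mul f g)
  inv_mem' {f} hf := by
    change (Function.mulSupport f⁻¹).Finite
    rw [Function.mulSupport_inv]
    exact hf

theorem FinLamps.shift_mem {A : Type*} [Group A] (i : ℤ) {f : ℤ → A} (hf : f ∈ FinLamps A) :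
    (fun x => f (x - i)) ∈ FinLamps A :=
  Set.Finite.preimage (f := fun x : ℤ => x - i) (sub_left_injective.injOn) hf

/-- The shift action of `ℤ` on `∑_ℤ A`, `(f^i)(x) = f (x - i)`. -/
def lampShift (A : Type*) [Group A] : Multiplicative ℤ →* MulAut (FinLamps A) where
  toFun i :=
    { toFun := fun f => ⟨fun x => f.1 (x - i.toAdd), FinLamps.shift_mem _ f.2⟩
      invFun := fun f => ⟨fun x => f.1 (x - -i.toAdd), FinLamps.shift_mem _ f.2⟩
      left_inv := fun f => by ext x; simp
      right_inv := fun f => by ext x; simp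
      map_mul' := fun f g => rfl }
  map_one' := by ext f x; simp
  map_mul' i j := by
    ext f x
    simp [sub_sub]

/-- The (restricted) wreath product `ℤ ≀ A`, with base `ℤ` and lamps in `A`. Multiplication is
`(i, f) (j, h) = (i + j, f * h^i)`. -/
abbrev ZWreath (A : Type*) [Group A] : Type _ :=
  SemidirectProduct (FinLamps A) (Multiplicative ℤ) (lampShift A)

/-- The function `ℤ → A` with value `x` at `0` and the identity elsewhere. -/
def lampFun {A : Type*} [Group A] (x : A) : FinLamps A :=
  ⟨Pi.mulSingle 0 x, (Set.finite_singleton (0 : ℤ)).subset Pi.mulSupport_mulSingle_subset⟩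

/-- The element of `ℤ ≀ A` that changes the lamp at `0` by `x` and does not move. -/
def lamp {A : Type*} [Group A] (x : A) : ZWreath A := SemidirectProduct.inl (lampFun x)

/-- The element `δ` of `ℤ ≀ A` that moves by `1` and changes no lamp. -/
def step (A : Type*) [Group A] : ZWreath A := SemidirectProduct.inr (Multiplicative.ofAdd 1)

/-- The elements `(a_i^e)^p δ (a_j^e)^q` with `p, q ∈ {0, 1, -1}`. -/
def switchWalkSwitch {A : Type*} [Group A] {k : ℕ} (a : Fin k → A) : Set (ZWreath A) :=
  {g | ∃ i j : Fin k, ∃ p ∈ ({0, 1, -1} : Set ℤ), ∃ q ∈ ({0, 1, -1} : Set ℤ),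
    g = lamp (a i) ^ p * step A * lamp (a j) ^ q}

/-! Let `S' = {1, a_i, a_i⁻¹}` as a set. An element of `T` is `x^e δ^ε y^e` with `x, y ∈ S'`, `ε =
±1`, and the triple `(x, ε, y)` is unique (`switchStep_injOn`). A uniform letter of `T` is therefore
a uniform triple: the position performs simple random walk on `ℤ`, and the switches are independent
of it and uniform on `S'`. Given the path, the lamp at `x` is distributed as the walk on `S'` at
time `v_x`, the number of switches at `x` (`wordAvg_lamp`).

The length of an element of `B` is at least half the sum of its lamp lengths
(`sum_lamps_le_wordLength`), and along a path it is at most twice that sum plus a multiple of the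
range (`wordLength_switchStep_le`), whose mean is `O(√n)`. The walk on `S'` is a time change of the
walk on `A`; its mean length is comparable to `m^α` for every `m ≥ 1`, and `0 ≤ α ≤ 1`
(`lazy_drift_bounds`).

It remains to estimate the mean of `∑ v_x^α`, where `∑ v_x = 2n`. Heuristically about `√n` sites
receive about `√n` switches each, which gives `n^((α+1)/2)`. The upper bound needs only the mean
range. The lower bound needs that local time does not concentrate on few sites: the mean of `∑ v_x²`
is `O(n^(3/2))` (`wordAvg_visitsSq_le`), by Tanaka's formula. -/

/-- The average of `F` over the words of length `n` with letters in `S`. -/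
noncomputable def wordAvg {β : Type*} (S : Finset β) : ℕ → (List β → ℝ) → ℝ
  | 0, F => F []
  | n + 1, F => (∑ s ∈ S, wordAvg S n fun w => F (s :: w)) / S.card

/-! ### Averages over words of fixed length. -/

section WordAvg

variable {β γ : Type*} {S : Finset β}

theorem wordAvg_zero (F : List β → ℝ) : wordAvg S 0 F = F [] := rfl

theorem wordAvg_succ (n : ℕ) (F : List β → ℝ) :
    wordAvg S (n + 1) F = (∑ s ∈ S, wordAvg S n fun w => F (s :: w)) / S.card := rfl

theorem wordAvg_mono {n : ℕ} {F F' : List β → ℝ}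
    (h : ∀ w : List β, w.length = n → (∀ s ∈ w, s ∈ S) → F w ≤ F' w) :
    wordAvg S n F ≤ wordAvg S n F' := by
  induction n generalizing F F' with
  | zero => exact h [] rfl (by simp)
  | succ n ih =>
    rw [wordAvg_succ, wordAvg_succ]
    gcongr with s hs
    refine ih fun w hw hw' => h _ (by simp [hw]) ?_
    intro t ht
    rcases List.mem_cons.1 ht with rfl | ht
    exacts [hs, hw' t ht]

theorem wordAvg_congr {n : ℕ} {F F' : List β → ℝ}
    (h : ∀ w : List β, w.length = n → (∀ s ∈ w, s ∈ S) → F w = F' w) :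
    wordAvg S n F = wordAvg S n F' :=
  le_antisymm (wordAvg_mono fun w h1 h2 => (h w h1 h2).le)
    (wordAvg_mono fun w h1 h2 => (h w h1 h2).ge)

theorem wordAvg_add (n : ℕ) (F F' : List β → ℝ) :
    wordAvg S n (fun w => F w + F' w) = wordAvg S n F + wordAvg S n F' := by
  induction n generalizing F F' with
  | zero => rfl
  | succ n ih => simp only [wordAvg_succ, ih, Finset.sum_add_distrib, add_div]

theorem wordAvg_const_mul (n : ℕ) (c : ℝ) (F : List β → ℝ) :
    wordAvg S n (fun w => c * F w) = c * wordAvg S n F := by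
  induction n generalizing F with
  | zero => rfl
  | succ n ih => simp only [wordAvg_succ, ih, ← Finset.mul_sum, mul_div_assoc]

theorem wordAvg_sub (n : ℕ) (F F' : List β → ℝ) :
    wordAvg S n (fun w => F w - F' w) = wordAvg S n F - wordAvg S n F' := by
  have h := wordAvg_add (S := S) n F (fun w => (-1) * F' w)
  rw [wordAvg_const_mul] at h
  simpa [sub_eq_add_neg] using h

theorem wordAvg_const (hS : S.Nonempty) (n : ℕ) (c : ℝ) : wordAvg S n (fun _ => c) = c := by
  have : (S.card : ℝ) ≠ 0 := by exact_mod_cast hS.card_pos.ne'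
  induction n with
  | zero => rfl
  | succ n ih => simp [wordAvg_succ, ih, this]

theorem wordAvg_finset_sum {ι : Type*} (n : ℕ) (I : Finset ι) (F : ι → List β → ℝ) :
    wordAvg S n (fun w => ∑ i ∈ I, F i w) = ∑ i ∈ I, wordAvg S n (F i) := by
  induction n generalizing F with
  | zero => rfl
  | succ n ih =>
    simp only [wordAvg_succ, ih, ← Finset.sum_div]
    rw [Finset.sum_comm]

theorem wordAvg_image [DecidableEq γ] {f : β → γ} (hf : Set.InjOn f S) (n : ℕ)
    (F : List γ → ℝ) :
    wordAvg (S.image f) n F = wordAvg S n fun w => F (w.map f) := by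
  induction n generalizing F with
  | zero => rfl
  | succ n ih =>
    simp only [wordAvg_succ, ih, Finset.sum_image hf, Finset.card_image_of_injOn hf, List.map_cons]

theorem hasSum_wordAvg {ι : Type*} (n : ℕ) {F : ι → List β → ℝ} {F' : List β → ℝ}
    (h : ∀ w, HasSum (fun i => F i w) (F' w)) :
    HasSum (fun i => wordAvg S n (F i)) (wordAvg S n F') := by
  induction n generalizing F F' with
  | zero => exact h []
  | succ n ih =>
    simp only [wordAvg_succ]
    exact (hasSum_sum fun s _ => ih fun w => h (s :: w)).div_const _

end WordAvg

/-! ### Random walks as averages over words. -/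

/-- The mean of `φ` under the `n`-step distribution of the random walk with uniform steps in
`S`. -/
noncomputable def walkMean {G : Type*} [Group G] (S : Finset G) (n : ℕ) (φ : G → ℝ) : ℝ :=
  wordAvg S n fun w => φ w.prod

section WalkMean

variable {G : Type*} [Group G] {S : Finset G}

theorem walkMean_zero (φ : G → ℝ) : walkMean S 0 φ = φ 1 := by simp [walkMean, wordAvg_zero]

theorem walkMean_succ (n : ℕ) (φ : G → ℝ) :
    walkMean S (n + 1) φ = (∑ s ∈ S, walkMean S n fun g => φ (s * g)) / S.card := by
  simp [walkMean, wordAvg_succ]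

/-- `convPow` appends letters on the right and `wordAvg` prepends them on the left; associativity
reconciles the two recursions. -/
theorem walkMean_succ' (n : ℕ) (φ : G → ℝ) :
    walkMean S (n + 1) φ = (∑ s ∈ S, walkMean S n fun g => φ (g * s)) / S.card := by
  induction n generalizing φ with
  | zero => simp [walkMean_succ, walkMean_zero]
  | succ n ih =>
    rw [walkMean_succ]
    conv_lhs => simp only [ih]
    conv_rhs => simp only [walkMean_succ n]
    simp only [← Finset.sum_div, mul_assoc]
    rw [Finset.sum_comm]

theorem convPow_toReal_eq_walkMean [DecidableEq G] (hS : S.Nonempty) (n : ℕ) (g : G) :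
    (convPow (PMF.uniformOfFinset S hS) n g).toReal =
      walkMean S n fun h => if h = g then 1 else 0 := by
  induction n generalizing g with
  | zero =>
    simp only [convPow, walkMean_zero, PMF.pure_apply, eq_comm]
    split_ifs <;> simp
  | succ n ih =>
    have key : convPow (PMF.uniformOfFinset S hS) (n + 1) g =
        ∑ s ∈ S, convPow (PMF.uniformOfFinset S hS) n (g * s⁻¹) * (S.card : ENNReal)⁻¹ := by
      simp only [convPow, PMF.bind_apply, PMF.pure_apply, ← ENNReal.tsum_mul_left]
      rw [ENNReal.tsum_comm, tsum_eq_sum (s := S)]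
      · refine Finset.sum_congr rfl fun s hs => ?_
        rw [tsum_eq_single (g * s⁻¹)]
        · simp [PMF.uniformOfFinset_apply_of_mem hS hs]
        · intro h hh
          have : g ≠ h * s := fun e => hh (by simp [e])
          simp [this]
      · intro s hs
        simp [PMF.uniformOfFinset_apply_of_notMem hS hs]
    rw [key, ENNReal.toReal_sum, walkMean_succ', Finset.sum_div]
    · refine Finset.sum_congr rfl fun s _ => ?_
      simp [ih, div_eq_mul_inv, eq_mul_inv_iff_mul_eq]
    · intro s hs
      refine ENNReal.mul_ne_top (PMF.apply_ne_top _ _) ?_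
      simpa using hS.ne_empty

theorem simpleDrift_eq_walkMean (hS : S.Nonempty) (n : ℕ) :
    simpleDrift S hS n = walkMean S n fun g => (wordLength (S : Set G) g : ℝ) := by
  classical
  simp only [simpleDrift, convPow_toReal_eq_walkMean]
  refine HasSum.tsum_eq ?_
  have h := hasSum_wordAvg (S := S) n
    (F := fun g w => (wordLength (S : Set G) g : ℝ) * if w.prod = g then 1 else 0)
    (F' := fun w => (wordLength (S : Set G) w.prod : ℝ)) fun w => by
      convert hasSum_single w.prod ?_ using 1
      · simp
      · intro g hg
        simp [hg.symm]
  simp only [wordAvg_const_mul] at h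
  simpa only [mul_comm, walkMean] using h

theorem walkMean_nonneg (hS : S.Nonempty) {n : ℕ} {φ : G → ℝ} (h : ∀ g, 0 ≤ φ g) :
    0 ≤ walkMean S n φ := by
  rw [← wordAvg_const hS n 0]
  exact wordAvg_mono fun _ _ _ => h _

end WalkMean

/-! ### Word length. -/

/-- `g` is a product of at most `n` elements of `S`. -/
def HasWord {G : Type*} [Group G] (S : Set G) (n : ℕ) (g : G) : Prop :=
  ∃ w : List G, w.length ≤ n ∧ (∀ x ∈ w, x ∈ S) ∧ w.prod = g

section Words

variable {G : Type*} [Group G] {S : Set G}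

theorem HasWord.one (S : Set G) : HasWord S 0 (1 : G) := ⟨[], by simp⟩

theorem HasWord.of_mem {g : G} (hg : g ∈ S) : HasWord S 1 g := ⟨[g], by simpa using hg⟩

theorem HasWord.mul {m n : ℕ} {g h : G} (hg : HasWord S m g) (hh : HasWord S n h) :
    HasWord S (m + n) (g * h) := by
  obtain ⟨v, hv, hv', rfl⟩ := hg
  obtain ⟨w, hw, hw', rfl⟩ := hh
  refine ⟨v ++ w, by simp; omega, ?_, by simp⟩
  intro x hx
  rcases List.mem_append.1 hx with hx | hx
  exacts [hv' x hx, hw' x hx]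

theorem HasWord.mono {m n : ℕ} {g : G} (hg : HasWord S m g) (h : m ≤ n) : HasWord S n g := by
  obtain ⟨v, hv, hv', rfl⟩ := hg
  exact ⟨v, hv.trans h, hv', rfl⟩

theorem HasWord.pow {g : G} {m : ℕ} (hg : HasWord S m g) (n : ℕ) : HasWord S (n * m) (g ^ n) := by
  induction n with
  | zero => simpa using HasWord.one S
  | succ n ih => rw [pow_succ, add_mul, one_mul]; exact ih.mul hg

theorem HasWord.zpow {g : G} {m : ℕ} (hg : HasWord S m g) (hg' : HasWord S m g⁻¹) (n : ℤ) :
    HasWord S (n.natAbs * m) (g ^ n) := by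
  rcases n.natAbs_eq with h | h
  · have := hg.pow n.natAbs
    rwa [← zpow_natCast, ← h] at this
  · have := hg'.pow n.natAbs
    rwa [← zpow_natCast, inv_zpow, ← zpow_neg, ← h] at this

theorem HasWord.mem_closure {g : G} {m : ℕ} (hg : HasWord S m g) : g ∈ Subgroup.closure S := by
  obtain ⟨v, -, hv', rfl⟩ := hg
  exact Subgroup.list_prod_mem _ fun x hx => Subgroup.subset_closure (hv' x hx)

theorem HasWord.wordLength_le {g : G} {m : ℕ} (hg : HasWord S m g) : wordLength S g ≤ m := by
  obtain ⟨v, hv, hv', rfl⟩ := hg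
  refine le_trans (Nat.sInf_le ?_) hv
  exact ⟨v, rfl, fun x hx => Or.inl (hv' x hx), rfl⟩

/-- Generation makes the set under `sInf` nonempty, which excludes the default value `0`; symmetry
turns inverse letters into letters. -/
theorem hasWord_wordLength (hinv : ∀ g ∈ S, g⁻¹ ∈ S) (hS : Subgroup.closure S = ⊤) (g : G) :
    HasWord S (wordLength S g) g := by
  have hne : {m : ℕ | ∃ w : List G, w.length = m ∧ (∀ x ∈ w, x ∈ S ∨ x⁻¹ ∈ S) ∧
      w.prod = g}.Nonempty := by
    have hg : g ∈ (Subgroup.closure S).toSubmonoid := by simp [hS]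
    rw [Subgroup.closure_toSubmonoid] at hg
    obtain ⟨w, hw, hw'⟩ := Submonoid.exists_list_of_mem_closure hg
    exact ⟨_, w, rfl, hw, hw'⟩
  obtain ⟨w, hw, hw', h⟩ := Nat.sInf_mem hne
  refine ⟨w, hw.le, fun x hx => ?_, h⟩
  rcases hw' x hx with h | h
  · exact h
  · simpa using hinv _ h

theorem wordLength_one : wordLength S (1 : G) = 0 :=
  Nat.le_zero.1 (HasWord.one S).wordLength_le

theorem wordLength_mul_le (hinv : ∀ g ∈ S, g⁻¹ ∈ S) (hS : Subgroup.closure S = ⊤) (g h : G) :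
    wordLength S (g * h) ≤ wordLength S g + wordLength S h :=
  ((hasWord_wordLength hinv hS g).mul (hasWord_wordLength hinv hS h)).wordLength_le

theorem one_le_wordLength (hinv : ∀ g ∈ S, g⁻¹ ∈ S) (hS : Subgroup.closure S = ⊤) {g : G}
    (hg : g ≠ 1) : 1 ≤ wordLength S g := by
  by_contra! h
  obtain ⟨w, hw, -, rfl⟩ := hasWord_wordLength hinv hS g
  have : w = [] := List.length_eq_zero_iff.1 (by omega)
  exact hg (by simp [this])

end Words

/-! ### Coordinates in the wreath product. -/

/-- The element `x^e δ^ε y^e` of `ℤ ≀ A`. -/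
noncomputable def switchStep {A : Type*} [Group A] (t : A × ℤ × A) : ZWreath A :=
  lamp t.1 * step A ^ t.2.1 * lamp t.2.2

section Wreath

variable {A : Type*} [Group A]

theorem step_zpow (n : ℤ) :
    step A ^ n = (SemidirectProduct.inr (Multiplicative.ofAdd n) : ZWreath A) := by
  rw [step, ← map_zpow, ← ofAdd_zsmul]
  simp

theorem lamp_zpow (x : A) (n : ℤ) : lamp x ^ n = lamp (x ^ n) := by
  have h : ∀ y, lamp y = (SemidirectProduct.inl.comp
      ({ toFun := lampFun, map_one' := by ext; simp [lampFun],
         map_mul' := fun u v => by ext z; simp [lampFun, Pi.mulSingle_mul] } :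
        A →* FinLamps A) : A →* ZWreath A) y := fun y => rfl
  rw [h, h, map_zpow]

theorem lamp_one : lamp (1 : A) = 1 := by simpa using (lamp_zpow (1 : A) 0).symm

theorem lamp_inv (x : A) : (lamp x)⁻¹ = lamp x⁻¹ := by simpa using lamp_zpow x (-1)

theorem lamp_mul (x y : A) : lamp (x * y) = lamp x * lamp y := by
  rw [lamp, lamp, lamp, ← map_mul]
  congr 1
  ext z
  simp [lampFun, Pi.mulSingle_mul]

theorem lampShift_apply_coe (i : Multiplicative ℤ) (f : FinLamps A) (x : ℤ) :
    (lampShift A i f).1 x = f.1 (x - i.toAdd) := rfl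

theorem switchStep_mul_right (t : A × ℤ × A) (g : ZWreath A) :
    (switchStep t * g).right = Multiplicative.ofAdd t.2.1 * g.right := by
  simp [switchStep, lamp, step_zpow]

theorem switchStep_mul_left (t : A × ℤ × A) (g : ZWreath A) (x : ℤ) :
    (switchStep t * g).left.1 x =
      (if x = 0 then t.1 else 1) * (if x = t.2.1 then t.2.2 else 1) *
        g.left.1 (x - t.2.1) := by
  simp [switchStep, lamp, step_zpow, lampShift_apply_coe, lampFun, Pi.mulSingle_apply, sub_eq_zero,
    -mul_ite, -ite_mul]

theorem switchStep_inv (t : A × ℤ × A) :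
    (switchStep t)⁻¹ = switchStep (t.2.2⁻¹, -t.2.1, t.1⁻¹) := by
  simp [switchStep, lamp_inv, mul_assoc]

/-- Since `ε ≠ 0`, the two switches act at the distinct sites `0` and `ε`, so both can be read off
from the lamps. -/
theorem switchStep_injOn :
    Set.InjOn (switchStep : A × ℤ × A → ZWreath A) {t | t.2.1 = 1 ∨ t.2.1 = -1} := by
  rintro ⟨s, e, s'⟩ ht ⟨r, d, r'⟩ ht' h
  have h1 := congrArg (fun g : ZWreath A => g.right.toAdd) h
  have h2 := fun x => congrArg (fun g : ZWreath A => g.left.1 x) h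
  have h3 := switchStep_mul_right (s, e, s') 1
  have h4 := switchStep_mul_right (r, d, r') 1
  have h5 := switchStep_mul_left (s, e, s') 1
  have h6 := switchStep_mul_left (r, d, r') 1
  rw [mul_one] at h3 h4 h5 h6
  simp only [h3, h4, h5, h6] at h1 h2
  obtain rfl : e = d := by simpa using h1
  have he : e ≠ 0 := by rintro rfl; simp at ht
  have h7 := h2 0
  have h8 := h2 e
  simp [he, he.symm] at h7 h8
  simp [h7, h8]

end Wreath

/-! ### Uniform switch-walk-switch triples. -/

/-- The triples `(x, ε, y)` with `x, y ∈ S` and `ε = ±1`. -/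
def switchTriples {A : Type*} (S : Finset A) : Finset (A × ℤ × A) :=
  S ×ˢ ({1, -1} : Finset ℤ) ×ˢ S

section Triples

variable {A : Type*} {S : Finset A}

theorem mem_switchTriples {t : A × ℤ × A} :
    t ∈ switchTriples S ↔ t.1 ∈ S ∧ (t.2.1 = 1 ∨ t.2.1 = -1) ∧ t.2.2 ∈ S := by
  simp [switchTriples]

theorem switchTriples_nonempty (hS : S.Nonempty) : (switchTriples S).Nonempty :=
  hS.product (Finset.Nonempty.product (by simp) hS)

theorem card_switchTriples : (switchTriples S).card = S.card * (2 * S.card) := by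
  simp [switchTriples]

theorem sum_switchTriples (F : A × ℤ × A → ℝ) :
    ∑ t ∈ switchTriples S, F t = ∑ s ∈ S, ∑ s' ∈ S, (F (s, 1, s') + F (s, -1, s')) := by
  simp [switchTriples, Finset.sum_product, Finset.sum_add_distrib]

/-- The first step formula for functionals that do not depend on the lamps of the first letter. -/
theorem wordAvg_switchTriples_succ (hS : S.Nonempty) (n : ℕ) {F : List (A × ℤ × A) → ℝ}
    (G : ℤ → List (A × ℤ × A) → ℝ) (h : ∀ t w, F (t :: w) = G t.2.1 w) :
    wordAvg (switchTriples S) (n + 1) F =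
      (wordAvg (switchTriples S) n (G 1) + wordAvg (switchTriples S) n (G (-1))) / 2 := by
  have : (S.card : ℝ) ≠ 0 := by exact_mod_cast hS.card_pos.ne'
  rw [wordAvg_succ, sum_switchTriples, card_switchTriples]
  simp only [h, Finset.sum_const, nsmul_eq_mul]
  push_cast
  field_simp

end Triples

/-! ### The law of one lamp given the path. -/

section Lamps

variable {A : Type*} [Group A]

/-- The number of switches at `x` along the path of the word `w`. -/
def visits {A : Type*} : List (A × ℤ × A) → ℤ → ℕ
  | [], _ => 0
  | t :: w, x => (if x = 0 then 1 else 0) + (if x = t.2.1 then 1 else 0) + visits w (x - t.2.1)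

/-- The path depends only on the `ε` entries, so the switches at `x` are independent uniform letters
given the path. Peeling off the first letter moves the origin by `ε`, hence the induction over all
`x` and `φ`. -/
theorem wordAvg_lamp {S : Finset A} (hS : S.Nonempty) (n : ℕ) (x : ℤ) (φ : A → ℝ) :
    wordAvg (switchTriples S) n (fun w => φ ((w.map switchStep).prod.left.1 x)) =
      wordAvg (switchTriples S) n fun w => walkMean S (visits w x) φ := by
  have hc : (S.card : ℝ) ≠ 0 := by exact_mod_cast hS.card_pos.ne'
  induction n generalizing φ x with
  | zero => simp [wordAvg_zero, visits, walkMean_zero]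
  | succ n ih =>
    -- Averaging over a switch adds one step to the walk when the switch acts at `x` (condition
    -- `b`), and does nothing otherwise.
    have avg : ∀ (b : Prop) [Decidable b] (m : ℕ) (ψ : A → ℝ),
        (∑ s ∈ S, walkMean S m fun g => ψ ((if b then s else 1) * g)) =
          S.card * walkMean S ((if b then 1 else 0) + m) ψ := by
      intro b _ m ψ
      split_ifs
      · rw [add_comm, walkMean_succ]
        field_simp
      · simp
    have hsum : ∀ e : ℤ, (∑ s ∈ S, ∑ s' ∈ S, wordAvg (switchTriples S) n fun w =>
        φ ((List.map switchStep ((s, e, s') :: w)).prod.left.1 x)) =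
        S.card * (S.card * wordAvg (switchTriples S) n fun w =>
          walkMean S ((if x = 0 then 1 else 0) + (if x = e then 1 else 0) +
            visits w (x - e)) φ) := by
      intro e
      have first : ∀ s s' : A, (wordAvg (switchTriples S) n fun w =>
          φ ((List.map switchStep ((s, e, s') :: w)).prod.left.1 x)) =
          wordAvg (switchTriples S) n fun w => walkMean S (visits w (x - e)) fun g =>
            φ ((if x = 0 then s else 1) * ((if x = e then s' else 1) * g)) := by
        intro s s'
        rw [← ih (x - e)]
        simp only [List.map_cons, List.prod_cons, switchStep_mul_left, mul_assoc]
      simp only [first]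
      simp only [← wordAvg_const_mul, ← wordAvg_finset_sum]
      refine wordAvg_congr fun w _ _ => ?_
      simp only [fun (s : A) (m : ℕ) => avg (x = e) m fun g => φ ((if x = 0 then s else 1) * g)]
      rw [← Finset.mul_sum, avg, add_assoc]
    rw [wordAvg_switchTriples_succ hS n (F := fun w => walkMean S (visits w x) φ)
      (fun e w => walkMean S ((if x = 0 then 1 else 0) +
      (if x = e then 1 else 0) + visits w (x - e)) φ) (fun _ _ => rfl), wordAvg_succ,
      sum_switchTriples, card_switchTriples]
    simp only [Finset.sum_add_distrib, hsum]
    push_cast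
    field_simp

end Lamps

/-! ### Range and local times of simple random walk on `ℤ`. -/

section PathStatistics

variable {A : Type*} {S : Finset A}

/-- The largest coordinate, in the direction `σ = ±1`, along the path of a word. -/
def reach {A : Type*} (σ : ℤ) : List (A × ℤ × A) → ℤ
  | [] => 0
  | t :: w => max 0 (σ * t.2.1 + reach σ w)

/-- The endpoint of the path of a word. -/
def endpoint {A : Type*} : List (A × ℤ × A) → ℤ
  | [] => 0
  | t :: w => t.2.1 + endpoint w

/-- The value of `∑ x, visits w x ^ 2`. -/
def visitsSq {A : Type*} : List (A × ℤ × A) → ℝ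
  | [] => 0
  | t :: w => visitsSq w + 2 * (visits w (-t.2.1) + visits w 0) + 2

theorem reach_nonneg (σ : ℤ) (w : List (A × ℤ × A)) : 0 ≤ reach σ w := by
  cases w <;> simp [reach]

theorem endpoint_le_reach (w : List (A × ℤ × A)) : endpoint w ≤ reach 1 w := by
  induction w with
  | nil => simp [reach, endpoint]
  | cons t w ih => simp only [reach, endpoint]; omega

theorem neg_reach_le_endpoint (w : List (A × ℤ × A)) : -reach (-1) w ≤ endpoint w := by
  induction w with
  | nil => simp [reach, endpoint]
  | cons t w ih => simp only [reach, endpoint]; omega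

theorem reach_le_length {w : List (A × ℤ × A)} (hw : ∀ t ∈ w, t ∈ switchTriples S) {σ : ℤ}
    (hσ : σ = 1 ∨ σ = -1) : reach σ w ≤ w.length := by
  induction w with
  | nil => simp [reach]
  | cons t w ih =>
    have h1 := ih fun t ht => hw t (by simp [ht])
    have h2 := (mem_switchTriples.1 (hw t (by simp))).2.1
    simp only [reach, List.length_cons]
    rcases hσ with rfl | rfl <;> push_cast <;> omega

theorem visits_eq_zero {w : List (A × ℤ × A)} {x : ℤ}
    (hx : x < -reach (-1) w ∨ reach 1 w < x) : visits w x = 0 := by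
  induction w generalizing x with
  | nil => rfl
  | cons t w ih =>
    simp only [reach] at hx
    have h1 := reach_nonneg 1 w
    have h2 := reach_nonneg (-1) w
    rw [visits, ih (by omega), if_neg (by omega), if_neg (by omega)]

theorem hasSum_visits (w : List (A × ℤ × A)) :
    HasSum (fun x => (visits w x : ℝ)) (2 * w.length) := by
  induction w with
  | nil => simp [visits]
  | cons t w ih =>
    have h1 := hasSum_ite_eq (0 : ℤ) (1 : ℝ)
    have h2 := hasSum_ite_eq t.2.1 (1 : ℝ)
    have h3 := (Equiv.subRight t.2.1).hasSum_iff.2 ih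
    convert (h1.add h2).add h3 using 1
    · ext x; simp [visits]
    · simp; ring

theorem hasSum_visits_sq {w : List (A × ℤ × A)} (hw : ∀ t ∈ w, t ∈ switchTriples S) :
    HasSum (fun x => (visits w x : ℝ) ^ 2) (visitsSq w) := by
  induction w with
  | nil => simp [visits, visitsSq]
  | cons t w ih =>
    have ht := (mem_switchTriples.1 (hw t (by simp))).2.1
    have h1 := hasSum_ite_eq (0 : ℤ) (2 * (visits w (-t.2.1) : ℝ) + 1)
    have h2 := hasSum_ite_eq t.2.1 (2 * (visits w 0 : ℝ) + 1)
    have h3 := (Equiv.subRight t.2.1).hasSum_iff.2 (ih fun t ht => hw t (by simp [ht]))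
    convert (h1.add h2).add h3 using 1
    · ext x
      -- The two switches of a letter are at different sites, so the square has no cross term
      -- between them.
      have : ¬ (x = 0 ∧ x = t.2.1) := by omega
      by_cases h0 : x = 0
      · have h0' : x ≠ t.2.1 := by tauto
        subst h0
        simp [visits, h0']
        ring
      · by_cases h0' : x = t.2.1
        · subst h0'
          simp [visits, h0]
          ring
        · simp [visits, h0, h0']
    · simp [visitsSq]; ring

/-- Use `max(0, y)² ≤ y²`; the cross terms for `ε = 1` and `ε = -1` cancel, so each letter adds at
most `1`. -/
theorem wordAvg_reach_sq_le (hS : S.Nonempty) {σ : ℤ} (hσ : σ = 1 ∨ σ = -1) (n : ℕ) :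
    wordAvg (switchTriples S) n (fun w => (reach σ w : ℝ) ^ 2) ≤ n := by
  induction n with
  | zero => simp [wordAvg_zero, reach]
  | succ n ih =>
    have hT := switchTriples_nonempty hS
    rw [wordAvg_switchTriples_succ hS n
      (fun e w => ((max 0 (σ * e + reach σ w) : ℤ) : ℝ) ^ 2) (fun _ _ => rfl)]
    have key : ∀ e : ℤ, (e = 1 ∨ e = -1) → wordAvg (switchTriples S) n
        (fun w => ((max 0 (σ * e + reach σ w) : ℤ) : ℝ) ^ 2) ≤
        1 + 2 * σ * e * wordAvg (switchTriples S) n (fun w => (reach σ w : ℝ)) + n := by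
      intro e he
      calc _ ≤ wordAvg (switchTriples S) n
            (fun w => 1 + 2 * σ * e * (reach σ w : ℝ) + (reach σ w : ℝ) ^ 2) := by
            refine wordAvg_mono fun w _ _ => ?_
            have h1 : ((max 0 (σ * e + reach σ w) : ℤ) : ℝ) ^ 2 ≤
                (σ * e + reach σ w : ℝ) ^ 2 := by
              push_cast
              rcases max_cases (0 : ℝ) (σ * e + reach σ w) with h | h
              · rw [h.1]
                simpa using sq_nonneg _
              · rw [h.1]
            have h2 : (σ * e : ℝ) ^ 2 = 1 := by
              rcases hσ with rfl | rfl <;> rcases he with rfl | rfl <;> norm_num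
            nlinarith
        _ ≤ _ := by
            rw [wordAvg_add, wordAvg_add, wordAvg_const hT, wordAvg_const_mul]
            linarith
    have h1 := key 1 (by simp)
    have h2 := key (-1) (by simp)
    push_cast at h1 h2 ⊢
    linarith

theorem wordAvg_endpoint_sq (hS : S.Nonempty) (n : ℕ) :
    wordAvg (switchTriples S) n (fun w => (endpoint w : ℝ) ^ 2) = n := by
  induction n with
  | zero => simp [wordAvg_zero, endpoint]
  | succ n ih =>
    have hT := switchTriples_nonempty hS
    rw [wordAvg_switchTriples_succ hS n
      (fun e w => (e : ℝ) ^ 2 + 2 * e * (endpoint w : ℝ) + (endpoint w : ℝ) ^ 2)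
      (fun t w => by simp only [endpoint]; push_cast; ring)]
    simp only [wordAvg_add, wordAvg_const hT, wordAvg_const_mul, ih]
    push_cast
    ring

/-- Cauchy–Schwarz, in the form `2√n F ≤ F² + n`. -/
theorem wordAvg_le_sqrt {β : Type*} {T : Finset β} (hT : T.Nonempty) {n : ℕ} {F : List β → ℝ}
    (h : wordAvg T n (fun w => F w ^ 2) ≤ n) : wordAvg T n F ≤ √n := by
  rcases Nat.eq_zero_or_pos n with rfl | hn
  · simp only [wordAvg_zero, Nat.cast_zero, Real.sqrt_zero] at h ⊢
    nlinarith
  · have hs : 0 < √(n : ℝ) := by positivity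
    have hs2 : √(n : ℝ) ^ 2 = n := Real.sq_sqrt (by positivity)
    have key : wordAvg T n (fun w => 2 * √n * F w) ≤ wordAvg T n (fun w => F w ^ 2 + n) :=
      wordAvg_mono fun w _ _ => by nlinarith [sq_nonneg (F w - √n)]
    rw [wordAvg_const_mul, wordAvg_add, wordAvg_const hT] at key
    nlinarith

theorem wordAvg_reach_le (hS : S.Nonempty) {σ : ℤ} (hσ : σ = 1 ∨ σ = -1) (n : ℕ) :
    wordAvg (switchTriples S) n (fun w => (reach σ w : ℝ)) ≤ √n :=
  wordAvg_le_sqrt (switchTriples_nonempty hS) (wordAvg_reach_sq_le hS hσ n)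

/-- The discrete Laplacian of `|y|` is a point mass at `0`, the source of the local time in Tanaka's
formula. -/
theorem abs_sub_one_add_abs_add_one (y : ℤ) :
    |(y : ℝ) - 1| + |(y : ℝ) + 1| = 2 * |(y : ℝ)| + 2 * if y = 0 then 1 else 0 := by
  have : |y - 1| + |y + 1| = 2 * |y| + 2 * if y = 0 then 1 else 0 := by
    simp only [abs_eq_max_neg]
    split_ifs <;> omega
  exact_mod_cast this

/-- A discrete form of Tanaka's formula for the local time of the simple random walk on `ℤ`. -/
theorem wordAvg_visits_le_abs (hS : S.Nonempty) (n : ℕ) (y : ℤ) :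
    wordAvg (switchTriples S) n (fun w => (visits w y : ℝ)) ≤
      2 * (wordAvg (switchTriples S) n (fun w => |(y : ℝ) - endpoint w|) - |(y : ℝ)|) + 1 -
        if y = 0 then 1 else 0 := by
  induction n generalizing y with
  | zero =>
    simp only [wordAvg_zero, visits, endpoint]
    split_ifs <;> simp
  | succ n ih =>
    have hT := switchTriples_nonempty hS
    rw [wordAvg_switchTriples_succ hS n (fun e w => ((if y = 0 then 1 else 0) +
        (if y = e then 1 else 0) : ℝ) + (visits w (y - e) : ℝ))
        (fun t w => by simp [visits]),
      wordAvg_switchTriples_succ hS n (fun e w => |((y - e : ℤ) : ℝ) - endpoint w|)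
        (fun t w => by simp only [endpoint]; push_cast; ring_nf)]
    simp only [wordAvg_add, wordAvg_const hT]
    have h1 := ih (y - 1)
    have h2 := ih (y - -1)
    have h3 := abs_sub_one_add_abs_add_one y
    have e1 : (y - 1 = 0) ↔ y = 1 := by omega
    have e2 : (y - -1 = 0) ↔ y = -1 := by omega
    simp only [e1, e2] at h1 h2
    push_cast at h1 h2 ⊢
    simp only [sub_neg_eq_add] at h1 h2 ⊢
    linarith

theorem wordAvg_visits_le (hS : S.Nonempty) (n : ℕ) (y : ℤ) :
    wordAvg (switchTriples S) n (fun w => (visits w y : ℝ)) ≤ 2 * √n + 1 := by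
  have hT := switchTriples_nonempty hS
  have h1 := wordAvg_visits_le_abs hS n y
  have h2 : wordAvg (switchTriples S) n (fun w => |(endpoint w : ℝ)|) ≤ √n :=
    wordAvg_le_sqrt hT (by simpa using (wordAvg_endpoint_sq hS n).le)
  have h3 : wordAvg (switchTriples S) n (fun w => |(y : ℝ) - endpoint w|) ≤
      wordAvg (switchTriples S) n (fun w => |(y : ℝ)| + |(endpoint w : ℝ)|) :=
    wordAvg_mono fun w _ _ => abs_sub _ _
  rw [wordAvg_add, wordAvg_const hT] at h3
  have h4 : (0 : ℝ) ≤ if y = 0 then 1 else 0 := by positivity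
  linarith

theorem wordAvg_visitsSq_le (hS : S.Nonempty) (n : ℕ) :
    wordAvg (switchTriples S) n visitsSq ≤ n * (8 * √n + 6) := by
  -- Fixing `n` keeps `√n` constant in the induction: each letter adds at most `2 · 2(2√n + 1) + 2 =
  -- 8√n + 6`.
  suffices h : ∀ m ≤ n, wordAvg (switchTriples S) m visitsSq ≤ m * (8 * √n + 6) from h n le_rfl
  intro m hm
  induction m with
  | zero => simp [wordAvg_zero, visitsSq]
  | succ m ih =>
    have hT := switchTriples_nonempty hS
    rw [wordAvg_switchTriples_succ hS m
      (fun e w => visitsSq w + 2 * ((visits w (-e) : ℝ) + visits w 0) + 2) (fun _ _ => rfl)]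
    simp only [wordAvg_add, wordAvg_const hT, wordAvg_const_mul]
    have h0 := ih (by omega)
    have h1 := wordAvg_visits_le hS m 0
    have h2 := wordAvg_visits_le hS m (-1)
    have h3 := wordAvg_visits_le hS m 1
    have h4 : √(m : ℝ) ≤ √n := Real.sqrt_le_sqrt (by exact_mod_cast (by omega))
    rw [neg_neg]
    push_cast
    linarith

end PathStatistics

/-! ### Word length in the wreath product. -/

section WreathLength

variable {A : Type*} [Group A] {S : Finset A}

/-- The switch-walk-switch generators of `ℤ ≀ A` with switches in `S`. -/
noncomputable def switchGenerators {A : Type*} [Group A] (S : Finset A) : Finset (ZWreath A) :=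
  open Classical in (switchTriples S).image switchStep

theorem mem_switchGenerators {g : ZWreath A} :
    g ∈ switchGenerators S ↔ ∃ t ∈ switchTriples S, switchStep t = g := by
  simp [switchGenerators]

theorem switchGenerators_inv_mem (hinv : ∀ s ∈ S, s⁻¹ ∈ S) {g : ZWreath A}
    (hg : g ∈ switchGenerators S) : g⁻¹ ∈ switchGenerators S := by
  obtain ⟨t, ht, rfl⟩ := mem_switchGenerators.1 hg
  rw [mem_switchTriples] at ht
  refine mem_switchGenerators.2 ⟨_, ?_, (switchStep_inv t).symm⟩
  rw [mem_switchTriples]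
  refine ⟨hinv _ ht.2.2, ?_, hinv _ ht.1⟩
  dsimp only
  omega

theorem walkMean_switchGenerators (n : ℕ) (φ : ZWreath A → ℝ) :
    walkMean (switchGenerators S) n φ =
      wordAvg (switchTriples S) n fun w => φ (w.map switchStep).prod := by
  classical
  rw [walkMean, switchGenerators, wordAvg_image (switchStep_injOn.mono fun t ht =>
    (mem_switchTriples.1 ht).2.1)]

theorem hasWord_step (h1 : (1 : A) ∈ S) :
    HasWord (switchGenerators S : Set (ZWreath A)) 1 (step A) :=
  .of_mem (mem_switchGenerators.2
    ⟨(1, 1, 1), by simp [mem_switchTriples, h1], by simp [switchStep, lamp_one]⟩)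

theorem hasWord_step_zpow (hinv : ∀ s ∈ S, s⁻¹ ∈ S) (h1 : (1 : A) ∈ S) (i : ℤ) :
    HasWord (switchGenerators S : Set (ZWreath A)) i.natAbs (step A ^ i) := by
  have h : HasWord (switchGenerators S : Set (ZWreath A)) 1 (step A)⁻¹ := by
    refine .of_mem (switchGenerators_inv_mem hinv (mem_switchGenerators.2 ⟨(1, 1, 1), ?_, ?_⟩))
    · simp [mem_switchTriples, h1]
    · simp [switchStep, lamp_one]
  simpa using (hasWord_step h1).zpow h i

/-- Each letter `s` costs two generators, `s^e δ` and `δ⁻¹`. -/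
theorem hasWord_lamp (hinv : ∀ s ∈ S, s⁻¹ ∈ S) (h1 : (1 : A) ∈ S) {n : ℕ} {x : A}
    (hx : HasWord (S : Set A) n x) :
    HasWord (switchGenerators S : Set (ZWreath A)) (2 * n) (lamp x) := by
  obtain ⟨w, hw, hw', rfl⟩ := hx
  refine HasWord.mono ?_ (Nat.mul_le_mul_left 2 hw)
  clear hw
  induction w with
  | nil => simpa [lamp_one] using HasWord.one _
  | cons s w ih =>
    have hs : HasWord (switchGenerators S : Set (ZWreath A)) 1 (lamp s * step A) :=
      .of_mem (mem_switchGenerators.2 ⟨(s, 1, 1), by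
        simpa [mem_switchTriples, h1] using hw' s (by simp), by simp [switchStep, lamp_one]⟩)
    have hb := hasWord_step_zpow (S := S) hinv h1 (-1)
    have := (hs.mul hb).mul (ih fun x hx => hw' x (by simp [hx]))
    simp only [zpow_neg, zpow_one, mul_inv_cancel_right, ← lamp_mul] at this
    refine this.mono ?_
    simp
    omega

theorem lamp_mul_step_mul_right (x : A) (g : ZWreath A) :
    (lamp x * step A * g).right = Multiplicative.ofAdd 1 * g.right := by
  simpa [switchStep, lamp_one] using switchStep_mul_right (x, 1, 1) g

theorem lamp_mul_step_mul_left (x : A) (g : ZWreath A) (y : ℤ) :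
    (lamp x * step A * g).left.1 y = (if y = 0 then x else 1) * g.left.1 (y - 1) := by
  simpa [switchStep, lamp_one] using switchStep_mul_left (x, 1, 1) g y

theorem step_zpow_mul_right (i : ℤ) (g : ZWreath A) :
    (step A ^ i * g).right = Multiplicative.ofAdd i * g.right := by
  simpa [switchStep, lamp_one] using switchStep_mul_right (1, i, 1) g

theorem step_zpow_mul_left (i : ℤ) (g : ZWreath A) (y : ℤ) :
    (step A ^ i * g).left.1 y = g.left.1 (y - i) := by
  simpa [switchStep, lamp_one] using switchStep_mul_left (1, i, 1) g y

/-- A tour over an interval that carries all the lamps, starting at its left end. -/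
theorem hasWord_of_support_range (hinv : ∀ s ∈ S, s⁻¹ ∈ S) (h1 : (1 : A) ∈ S) {l : A → ℕ}
    (hl : ∀ x, HasWord (S : Set A) (l x) x) (r : ℕ) (g : ZWreath A)
    (hg : ∀ x : ℤ, (x < 0 ∨ r ≤ x) → g.left.1 x = 1) :
    HasWord (switchGenerators S : Set (ZWreath A))
      (r + (g.right.toAdd - r).natAbs + 2 * ∑ j ∈ Finset.range r, l (g.left.1 j)) g := by
  induction r generalizing g with
  | zero =>
    have : g = step A ^ g.right.toAdd := by
      rw [step_zpow]
      ext x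
      · simpa using hg x (by omega)
      · simp
    rw [this]
    refine (hasWord_step_zpow hinv h1 _).mono ?_
    simp [step_zpow]
  | succ r ih =>
    set x := g.left.1 0 with hx
    -- Set the leftmost lamp and step right; what remains is carried by an interval of length `r`.
    set h := (lamp x * step A)⁻¹ * g with hh
    have hgh : g = lamp x * step A * h := by rw [hh, mul_inv_cancel_left]
    have hleft : ∀ y, h.left.1 y = if y = -1 then 1 else g.left.1 (y + 1) := by
      intro y
      have h2 := lamp_mul_step_mul_left x h (y + 1)
      rw [← hgh] at h2
      have e : y + 1 = 0 ↔ y = -1 := by omega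
      simp only [e, add_sub_cancel_right] at h2
      split_ifs at h2 ⊢ with hy
      · subst hy
        simpa [hx] using h2
      · simpa using h2.symm
    have hright : h.right.toAdd = g.right.toAdd - 1 := by
      have := lamp_mul_step_mul_right x h
      rw [← hgh] at this
      simp [this]
    have hw := ih h fun y hy => by
      rw [hleft]
      split_ifs
      · rfl
      · exact hg _ (by push_cast; omega)
    have hs := (hasWord_lamp hinv h1 (hl x)).mul (hasWord_step h1)
    rw [hgh]
    refine (hs.mul hw).mono ?_
    rw [← hgh, Finset.sum_range_succ']
    have : ∀ j : ℕ, h.left.1 j = g.left.1 ((j + 1 : ℕ) : ℤ) := fun j => by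
      rw [hleft, if_neg (by omega)]
      simp
    simp only [this, hright, ← hx, Nat.cast_zero]
    push_cast
    have : (g.right.toAdd - 1 - r).natAbs = (g.right.toAdd - (r + 1)).natAbs := by congr 1; ring
    omega

theorem sum_Icc_eq_sum_range (f : ℤ → ℕ) (a : ℤ) (r : ℕ) :
    ∑ j ∈ Finset.range r, f (j - a) = ∑ x ∈ Finset.Ico (-a) (r - a), f x := by
  induction r with
  | zero => simp
  | succ r ih =>
    rw [Finset.sum_range_succ, ih]
    have : Finset.Ico (-a) (((r + 1 : ℕ) : ℤ) - a) = insert (r - a) (Finset.Ico (-a) (r - a)) := by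
      ext x
      simp
      omega
    rw [this, Finset.sum_insert (by simp)]
    ring

/-- Go to the left end of the interval, sweep to the right while setting lamps, then return to the
final position. -/
theorem hasWord_of_support_Icc (hinv : ∀ s ∈ S, s⁻¹ ∈ S) (h1 : (1 : A) ∈ S) {l : A → ℕ}
    (hl : ∀ x, HasWord (S : Set A) (l x) x) (m M : ℕ) (g : ZWreath A)
    (hg : ∀ x : ℤ, (x < -m ∨ M < x) → g.left.1 x = 1)
    (hm : -m ≤ g.right.toAdd) (hM : g.right.toAdd ≤ M) :
    HasWord (switchGenerators S : Set (ZWreath A))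
      (3 * (m + M) + 2 + 2 * ∑ x ∈ Finset.Icc (-m : ℤ) M, l (g.left.1 x)) g := by
  have h := hasWord_of_support_range hinv h1 hl (m + M + 1) (step A ^ (m : ℤ) * g)
    fun x hx => by
      rw [step_zpow_mul_left]
      exact hg _ (by push_cast at hx; omega)
  have hg' : g = step A ^ (-m : ℤ) * (step A ^ (m : ℤ) * g) := by simp
  rw [hg']
  refine ((hasWord_step_zpow hinv h1 (-m)).mul h).mono ?_
  rw [← hg']
  simp only [step_zpow_mul_left, step_zpow_mul_right, toAdd_mul, toAdd_ofAdd]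
  rw [sum_Icc_eq_sum_range (fun x => l (g.left.1 x))]
  have : Finset.Ico (-m : ℤ) (((m + M + 1 : ℕ) : ℤ) - m) = Finset.Icc (-m : ℤ) M := by
    ext x
    simp
    omega
  rw [this]
  push_cast
  omega

theorem closure_switchGenerators (hinv : ∀ s ∈ S, s⁻¹ ∈ S) (h1 : (1 : A) ∈ S)
    (hS : Subgroup.closure (S : Set A) = ⊤) :
    Subgroup.closure (switchGenerators S : Set (ZWreath A)) = ⊤ := by
  rw [eq_top_iff]
  intro g _
  obtain ⟨b, hb⟩ := (g.left.2 : (Function.mulSupport g.left.1).Finite).bddAbove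
  obtain ⟨c, hc⟩ := (g.left.2 : (Function.mulSupport g.left.1).Finite).bddBelow
  refine (hasWord_of_support_Icc hinv h1 (hasWord_wordLength (by simpa using hinv) hS)
    (c.natAbs + g.right.toAdd.natAbs) (b.natAbs + g.right.toAdd.natAbs) g ?_
    (by omega) (by omega)).mem_closure
  intro x hx
  by_contra hne
  have h2 := hb (Function.mem_mulSupport.2 hne)
  have h3 := hc (Function.mem_mulSupport.2 hne)
  simp only [Nat.cast_add] at hx
  omega

theorem word_right (w : List (A × ℤ × A)) :
    (w.map switchStep).prod.right.toAdd = endpoint w := by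
  induction w with
  | nil => simp [endpoint]
  | cons t w ih => rw [List.map_cons, List.prod_cons, switchStep_mul_right]; simp [ih, endpoint]

theorem word_left_eq_one {w : List (A × ℤ × A)} {x : ℤ}
    (hx : x < -reach (-1) w ∨ reach 1 w < x) : (w.map switchStep).prod.left.1 x = 1 := by
  induction w generalizing x with
  | nil => simp
  | cons t w ih =>
    simp only [reach] at hx
    have h1 := reach_nonneg 1 w
    have h2 := reach_nonneg (-1) w
    rw [List.map_cons, List.prod_cons, switchStep_mul_left, ih (by omega), if_neg (by omega),
      if_neg (by omega)]
    simp

theorem wordLength_switchStep_le (hinv : ∀ s ∈ S, s⁻¹ ∈ S) (h1 : (1 : A) ∈ S) {l : A → ℕ}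
    (hl : ∀ x, HasWord (S : Set A) (l x) x) (w : List (A × ℤ × A)) :
    (wordLength (switchGenerators S : Set (ZWreath A)) (w.map switchStep).prod : ℝ) ≤
      3 * (reach (-1) w + reach 1 w) + 2 +
        2 * ∑ x ∈ Finset.Icc (-reach (-1) w) (reach 1 w),
          (l ((w.map switchStep).prod.left.1 x) : ℝ) := by
  have hm := Int.toNat_of_nonneg (reach_nonneg (-1) w)
  have hM := Int.toNat_of_nonneg (reach_nonneg 1 w)
  have h := (hasWord_of_support_Icc hinv h1 hl (reach (-1) w).toNat (reach 1 w).toNat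
    (w.map switchStep).prod (fun x hx => word_left_eq_one (by rwa [hm, hM] at hx))
    (by rw [word_right, hm]; exact neg_reach_le_endpoint w)
    (by rw [word_right, hM]; exact endpoint_le_reach w)).wordLength_le
  rw [hm, hM] at h
  have hm' : (((reach (-1) w).toNat : ℕ) : ℝ) = reach (-1) w := by exact_mod_cast hm
  have hM' : (((reach 1 w).toNat : ℕ) : ℝ) = reach 1 w := by exact_mod_cast hM
  rw [← hm', ← hM']
  exact_mod_cast h

/-- A generator changes two lamps, each by one letter. -/
theorem sum_lamps_le {l : A → ℕ} (hl1 : l 1 = 0) (hl : ∀ s ∈ S, ∀ x, l (s * x) ≤ 1 + l x)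
    {w : List (A × ℤ × A)} (hw : ∀ t ∈ w, t ∈ switchTriples S) (F : Finset ℤ) :
    ∑ x ∈ F, l ((w.map switchStep).prod.left.1 x) ≤ 2 * w.length := by
  induction w generalizing F with
  | nil => simp [hl1]
  | cons t w ih =>
    have ht := mem_switchTriples.1 (hw t (by simp))
    set g := (w.map switchStep).prod
    calc ∑ x ∈ F, l (((t :: w).map switchStep).prod.left.1 x)
        ≤ ∑ x ∈ F, ((if x = 0 then 1 else 0) + (if x = t.2.1 then 1 else 0) +
            l (g.left.1 (x - t.2.1))) := by
          refine Finset.sum_le_sum fun x _ => ?_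
          rw [List.map_cons, List.prod_cons, switchStep_mul_left, mul_assoc, add_assoc]
          have a1 : ∀ y, l ((if x = 0 then t.1 else 1) * y) ≤ (if x = 0 then 1 else 0) + l y := by
            intro y
            split_ifs
            exacts [hl _ ht.1 y, by simp]
          have a2 : ∀ y, l ((if x = t.2.1 then t.2.2 else 1) * y) ≤
              (if x = t.2.1 then 1 else 0) + l y := by
            intro y
            split_ifs
            exacts [hl _ ht.2.2 y, by simp]
          exact (a1 _).trans (Nat.add_le_add_left (a2 _) _)
      _ ≤ 1 + 1 + ∑ x ∈ F.image (fun x => x - t.2.1), l (g.left.1 x) := by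
          rw [Finset.sum_add_distrib, Finset.sum_add_distrib,
            Finset.sum_image (fun x _ y _ h => by simpa using h)]
          gcongr
          · rw [Finset.sum_ite_eq']; split_ifs <;> simp
          · rw [Finset.sum_ite_eq']; split_ifs <;> simp
      _ ≤ _ := by
          have := ih (fun t ht => hw t (by simp [ht])) (F.image fun x => x - t.2.1)
          simp only [List.length_cons]
          omega

theorem sum_lamps_le_wordLength (hinv : ∀ s ∈ S, s⁻¹ ∈ S) (h1 : (1 : A) ∈ S)
    (hS : Subgroup.closure (S : Set A) = ⊤) {l : A → ℕ} (hl1 : l 1 = 0)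
    (hl : ∀ s ∈ S, ∀ x, l (s * x) ≤ 1 + l x) (g : ZWreath A) (F : Finset ℤ) :
    ∑ x ∈ F, l (g.left.1 x) ≤ 2 * wordLength (switchGenerators S : Set (ZWreath A)) g := by
  obtain ⟨v, hv, hv', hg⟩ := hasWord_wordLength (S := (switchGenerators S : Set (ZWreath A)))
    (fun g => switchGenerators_inv_mem hinv) (closure_switchGenerators hinv h1 hS) g
  -- A geodesic word in the generators lifts to a word in triples, to which `sum_lamps_le` applies.
  have : ∀ v : List (ZWreath A), (∀ x ∈ v, x ∈ switchGenerators S) →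
      ∃ w : List (A × ℤ × A), (∀ t ∈ w, t ∈ switchTriples S) ∧ w.map switchStep = v := by
    intro v
    induction v with
    | nil => exact fun _ => ⟨[], by simp⟩
    | cons b v ih =>
      intro h
      obtain ⟨w, hw, rfl⟩ := ih fun x hx => h x (by simp [hx])
      obtain ⟨t, ht, rfl⟩ := mem_switchGenerators.1 (h b (by simp))
      exact ⟨t :: w, by simpa [ht] using hw, by simp⟩
  obtain ⟨w, hw, rfl⟩ := this v hv'
  have h2 := sum_lamps_le hl1 hl hw F
  rw [List.length_map] at hv
  rw [hg] at h2
  omega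

end WreathLength

/-! ### The lazy walk as a time change. -/

section LazyWalk

theorem wordAvg_countP {β : Type*} [DecidableEq β] {S S' : Finset β} (hS' : S'.Nonempty)
    (hSS' : S ⊆ S') (n : ℕ) :
    wordAvg S' n (fun w => (w.countP (· ∈ S) : ℝ)) = n * (S.card / S'.card) := by
  have hc : (S'.card : ℝ) ≠ 0 := by exact_mod_cast hS'.card_pos.ne'
  induction n with
  | zero => simp [wordAvg_zero]
  | succ n ih =>
    have : ∀ s : β, wordAvg S' n (fun w => ((s :: w).countP (· ∈ S) : ℝ)) =
        n * (S.card / S'.card) + if s ∈ S then 1 else 0 := fun s => by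
      simp only [List.countP_cons]
      push_cast
      rw [wordAvg_add, ih]
      congr 1
      split_ifs <;> simp_all [wordAvg_const hS']
    rw [wordAvg_succ]
    simp only [this]
    rw [Finset.sum_add_distrib, Finset.sum_ite_mem, Finset.inter_eq_right.2 hSS']
    simp
    field_simp

variable {G : Type*} [Group G] {S S' : Finset G}

/-- If the letters of `S'` outside `S` are trivial, then the walk on `S'` is a random time change of
the walk on `S`. -/
theorem walkMean_lazy [DecidableEq G] (hS : S.Nonempty) (hSS' : S ⊆ S') (h1 : ∀ s ∈ S', s ∉ S → s = 1) (n : ℕ)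
    (φ : G → ℝ) :
    walkMean S' n φ = wordAvg S' n fun w => walkMean S (w.countP (· ∈ S)) φ := by
  have hc : (S.card : ℝ) ≠ 0 := by exact_mod_cast hS.card_pos.ne'
  induction n generalizing φ with
  | zero => simp [walkMean_zero, wordAvg_zero]
  | succ n ih =>
    rw [walkMean_succ, wordAvg_succ]
    congr 1
    simp only [ih]
    rw [← wordAvg_finset_sum, ← wordAvg_finset_sum]
    refine wordAvg_congr fun w _ _ => ?_
    rw [← Finset.sum_sdiff hSS', ← Finset.sum_sdiff hSS']
    congr 1
    · refine Finset.sum_congr rfl fun s hs => ?_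
      rw [Finset.mem_sdiff] at hs
      rw [List.countP_cons_of_neg (by simpa using hs.2)]
      simp [h1 s hs.1 hs.2]
    · have : ∀ s ∈ S, walkMean S (List.countP (· ∈ S) (s :: w)) φ =
          walkMean S (List.countP (· ∈ S) w + 1) φ := fun s hs => by simp [hs]
      rw [Finset.sum_congr rfl this, walkMean_succ]
      simp only [Finset.sum_const, nsmul_eq_mul]
      field_simp

end LazyWalk

/-! ### The exponent, and the drift of the lazy walk on `A`. -/

section DriftBounds

open Filter

variable {G : Type*} [Group G] {S : Finset G}

theorem walkMean_wordLength_le (n : ℕ) (hS : S.Nonempty) :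
    walkMean S n (fun g => (wordLength (S : Set G) g : ℝ)) ≤ n := by
  rw [walkMean, ← wordAvg_const hS n (n : ℝ)]
  refine wordAvg_mono fun w hw hw' => ?_
  exact_mod_cast HasWord.wordLength_le ⟨w, hw.le, hw', rfl⟩

/-- For each `g`, at least one of `g` and `s * g` is nontrivial. Two consecutive times are needed
because the walk may be periodic. -/
theorem one_le_walkMean_add (hinv : ∀ g ∈ S, g⁻¹ ∈ S) (hgen : Subgroup.closure (S : Set G) = ⊤)
    {s : G} (hs : s ∈ S) (hs1 : s ≠ 1) (n : ℕ) :
    1 ≤ walkMean S n (fun g => (wordLength (S : Set G) g : ℝ)) +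
      S.card * walkMean S (n + 1) fun g => (wordLength (S : Set G) g : ℝ) := by
  have hS : S.Nonempty := ⟨s, hs⟩
  have hc : (S.card : ℝ) ≠ 0 := by exact_mod_cast hS.card_pos.ne'
  rw [walkMean_succ, mul_div_cancel₀ _ hc]
  have h1 : walkMean S n (fun g => (wordLength (S : Set G) (s * g) : ℝ)) ≤
      ∑ s ∈ S, walkMean S n fun g => (wordLength (S : Set G) (s * g) : ℝ) :=
    Finset.single_le_sum (f := fun s => walkMean S n fun g => (wordLength (S : Set G) (s * g) : ℝ))
      (fun s _ => walkMean_nonneg hS fun g => by positivity) hs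
  refine le_trans ?_ (add_le_add_right h1 _)
  rw [walkMean, walkMean, ← wordAvg_add]
  refine (wordAvg_const hS n 1).ge.trans (wordAvg_mono fun w _ _ => ?_)
  have hpos := fun {g : G} (hg : g ≠ 1) => one_le_wordLength (S := (S : Set G)) hinv hgen hg
  by_cases hw : w.prod = 1
  · have := hpos (g := s * w.prod) (by simpa [hw] using hs1)
    exact_mod_cast this.trans (Nat.le_add_left _ _)
  · have := hpos hw
    exact_mod_cast this.trans (Nat.le_add_right _ _)

theorem exists_drift_bounds {α : ℝ} {L : ℕ → ℝ} (hL0 : ∀ n, 0 ≤ L n)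
    (h : Asymptotics.IsTheta atTop L fun n : ℕ => (n : ℝ) ^ α) :
    ∃ c > 0, ∃ C > 0, ∃ N : ℕ, ∀ n ≥ N, c * (n : ℝ) ^ α ≤ L n ∧ L n ≤ C * (n : ℝ) ^ α := by
  obtain ⟨C, hC, hC'⟩ := h.1.exists_pos
  obtain ⟨D, hD, hD'⟩ := h.2.exists_pos
  obtain ⟨N, hN⟩ := eventually_atTop.1 (hC'.bound.and hD'.bound)
  refine ⟨D⁻¹, by positivity, C, hC, N, fun n hn => ?_⟩
  have hn0 : (0 : ℝ) ≤ (n : ℝ) ^ α := by positivity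
  have := hN n hn
  rw [Real.norm_of_nonneg hn0, Real.norm_of_nonneg (hL0 n)] at this
  exact ⟨(inv_mul_le_iff₀ hD).2 this.2, this.1⟩

theorem exponent_le_one {α c : ℝ} (hc : 0 < c) {N : ℕ}
    (h : ∀ n : ℕ, N ≤ n → c * (n : ℝ) ^ α ≤ n) : α ≤ 1 := by
  by_contra! hα
  have ht : Tendsto (fun n : ℕ => (n : ℝ) ^ (α - 1)) atTop atTop :=
    (tendsto_rpow_atTop (by linarith)).comp tendsto_natCast_atTop_atTop
  obtain ⟨n, h1, h2⟩ := ((ht.eventually_gt_atTop c⁻¹).and (eventually_ge_atTop (N + 1))).exists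
  have hn : (0 : ℝ) < n := by exact_mod_cast (by omega)
  have h3 := h n (by omega)
  rw [Real.rpow_sub_one hn.ne', lt_div_iff₀ hn, inv_mul_lt_iff₀ hc] at h1
  linarith

theorem exponent_nonneg {α C K : ℝ} (hK : 0 ≤ K) {L : ℕ → ℝ} {N : ℕ}
    (h : ∀ n : ℕ, N ≤ n → L n ≤ C * (n : ℝ) ^ α) (h' : ∀ n, 1 ≤ L n + K * L (n + 1)) : 0 ≤ α := by
  by_contra! hα
  have ht : Tendsto (fun n : ℕ => (n : ℝ) ^ α) atTop (nhds 0) := by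
    simpa [Function.comp_def] using
      (tendsto_rpow_neg_atTop (y := -α) (by linarith)).comp tendsto_natCast_atTop_atTop
  have ht' := (ht.const_mul C).add (((ht.comp (tendsto_add_atTop_nat 1)).const_mul C).const_mul K)
  have := ge_of_tendsto ht' (b := (1 : ℝ)) (by
    filter_upwards [eventually_ge_atTop N] with n hn
    have h1 := h n hn
    have h2 := mul_le_mul_of_nonneg_left (h (n + 1) (by omega)) hK
    exact (h' n).trans (add_le_add h1 h2))
  norm_num at this

/-- With positive probability one letter is `s` and all others are the added letter `1`. -/
theorem walkMean_insert_one_pos [DecidableEq G] (hinv : ∀ g ∈ S, g⁻¹ ∈ S)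
    (hgen : Subgroup.closure (S : Set G) = ⊤) {s : G} (hs : s ∈ S) (hs1 : s ≠ 1) (n : ℕ) :
    0 < walkMean (insert 1 S) (n + 1) fun g => (wordLength (S : Set G) g : ℝ) := by
  have hS' : (insert 1 S).Nonempty := ⟨1, by simp⟩
  have hc : (0 : ℝ) < (insert 1 S).card := by exact_mod_cast hS'.card_pos
  have step : ∀ n, ∀ r ∈ insert 1 S,
      (walkMean (insert 1 S) n fun g => (wordLength (S : Set G) (r * g) : ℝ)) / (insert 1 S).card ≤
      walkMean (insert 1 S) (n + 1) fun g => (wordLength (S : Set G) g : ℝ) := by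
    intro n r hr
    rw [walkMean_succ]
    gcongr
    exact Finset.single_le_sum
      (f := fun s => walkMean (insert 1 S) n fun g => (wordLength (S : Set G) (s * g) : ℝ))
      (fun s _ => walkMean_nonneg hS' fun g => by positivity) hr
  induction n with
  | zero =>
    refine lt_of_lt_of_le (div_pos ?_ hc) (step 0 s (by simp [hs]))
    have : 1 ≤ wordLength (S : Set G) s := one_le_wordLength hinv hgen hs1
    rw [walkMean_zero, mul_one]
    exact_mod_cast this
  | succ n ih =>
    refine lt_of_lt_of_le (div_pos ?_ hc) (step (n + 1) 1 (by simp))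
    simpa using ih

/-- The drift of the lazy walk is comparable to that of the walk. -/
theorem lazy_drift_bounds [DecidableEq G] (hS : S.Nonempty) (hinv : ∀ g ∈ S, g⁻¹ ∈ S)
    (hgen : Subgroup.closure (S : Set G) = ⊤) {α : ℝ}
    (hα : Asymptotics.IsTheta atTop (simpleDrift S hS) fun n : ℕ => (n : ℝ) ^ α) :
    0 ≤ α ∧ α ≤ 1 ∧ ∃ c > 0, ∃ C > 0, ∀ m : ℕ, 1 ≤ m →
      c * (m : ℝ) ^ α ≤ walkMean (insert 1 S) m (fun g => (wordLength (S : Set G) g : ℝ)) ∧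
      walkMean (insert 1 S) m (fun g => (wordLength (S : Set G) g : ℝ)) ≤ C * (m : ℝ) ^ α := by
  set l : G → ℝ := fun g => (wordLength (S : Set G) g : ℝ) with hl
  have hl0 : ∀ g, 0 ≤ l g := fun g => by positivity
  have hL : ∀ n, simpleDrift S hS n = walkMean S n l := simpleDrift_eq_walkMean hS
  have hLn : ∀ n, walkMean S n l ≤ n := fun n => walkMean_wordLength_le n hS
  have hL0 : ∀ n, 0 ≤ walkMean S n l := fun n => walkMean_nonneg hS hl0
  rw [show simpleDrift S hS = fun n => walkMean S n l from funext hL] at hα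
  obtain ⟨c, hc, C, hC, N, hN⟩ := exists_drift_bounds hL0 hα
  have hα1 : α ≤ 1 := exponent_le_one hc fun n hn => (hN n hn).1.trans (hLn n)
  -- If all letters were trivial, `A` would be trivial and its drift zero, not comparable to a power
  -- of `n`.
  obtain ⟨s, hs, hs1⟩ : ∃ s ∈ S, s ≠ 1 := by
    by_contra! hcon
    have hbot : (⊤ : Subgroup G) = ⊥ := by
      rw [← hgen, Subgroup.closure_eq_bot_iff]
      exact fun s hs => hcon s hs
    have hone : ∀ g : G, g = 1 := fun g => by
      have : g ∈ (⊤ : Subgroup G) := trivial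
      rw [hbot] at this
      exact this
    have h1 := (hN (N + 1) (by omega)).1
    have h2 : walkMean S (N + 1) l = 0 := by
      have : l = fun _ => 0 := funext fun g => by
        simp only [hl]
        rw [hone g, wordLength_one, Nat.cast_zero]
      rw [this, walkMean, wordAvg_const hS]
    rw [h2] at h1
    have : 0 < c * ((N + 1 : ℕ) : ℝ) ^ α := by positivity
    linarith
  have hα0 : 0 ≤ α := exponent_nonneg (Nat.cast_nonneg _) (fun n hn => (hN n hn).2)
    (one_le_walkMean_add hinv hgen hs hs1)
  -- Times below the threshold `N` contribute at most `N ≤ N n^α`, because `α ≥ 0`.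
  have hupper : ∀ m : ℕ, ∀ n : ℕ, 1 ≤ n → m ≤ n → walkMean S m l ≤ (C + N) * (n : ℝ) ^ α := by
    intro m n hn hmn
    have hn1 : 1 ≤ (n : ℝ) ^ α := Real.one_le_rpow (by exact_mod_cast hn) hα0
    rcases le_total N m with h | h
    · refine (hN m h).2.trans ?_
      have : (m : ℝ) ^ α ≤ (n : ℝ) ^ α :=
        Real.rpow_le_rpow (by positivity) (by exact_mod_cast hmn) hα0
      have hN0 : (0 : ℝ) ≤ N := by positivity
      nlinarith
    · have h1 : (m : ℝ) ≤ N := by exact_mod_cast h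
      have h2 := hLn m
      have : (0 : ℝ) ≤ C * (n : ℝ) ^ α := by positivity
      nlinarith [Nat.cast_nonneg (α := ℝ) N]
  -- As `α ≤ 1`, `m^α ≥ n^(α-1) m` for `0 < m ≤ n`. This minorant is linear in `m`, so only the mean
  -- of the random time is needed.
  have hlower : ∀ m : ℕ, ∀ n : ℕ, 1 ≤ n → m ≤ n →
      c * (n : ℝ) ^ (α - 1) * (m - N) ≤ walkMean S m l := by
    intro m n hn hmn
    rcases le_or_gt m N with h | h
    · refine le_trans ?_ (hL0 m)
      have h1 : (m : ℝ) ≤ N := by exact_mod_cast h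
      exact mul_nonpos_of_nonneg_of_nonpos (by positivity) (by linarith)
    · refine le_trans ?_ (hN m h.le).1
      have hm : (0 : ℝ) < m := by exact_mod_cast (by omega)
      have hmn' : (m : ℝ) ≤ n := by exact_mod_cast hmn
      have h1 : (n : ℝ) ^ (α - 1) ≤ (m : ℝ) ^ (α - 1) :=
        Real.rpow_le_rpow_of_nonpos hm hmn' (by linarith)
      have h2 : (m : ℝ) ^ α = (m : ℝ) ^ (α - 1) * m := by
        rw [Real.rpow_sub_one hm.ne']; field_simp
      have h3 : (N : ℝ) ≤ m := by exact_mod_cast h.le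
      rw [h2, mul_assoc]
      refine mul_le_mul_of_nonneg_left ?_ hc.le
      refine mul_le_mul h1 ?_ (by linarith) (by positivity)
      linarith [Nat.cast_nonneg (α := ℝ) N]
  have hS' : (insert 1 S).Nonempty := ⟨1, by simp⟩
  have hlazy := walkMean_lazy (S' := insert 1 S) hS (Finset.subset_insert 1 S)
    (fun s hs hs' => (Finset.mem_insert.1 hs).resolve_right hs')
  refine ⟨hα0, hα1, ?_⟩
  have hU : ∀ n : ℕ, 1 ≤ n → walkMean (insert 1 S) n l ≤ (C + N) * (n : ℝ) ^ α := by
    intro n hn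
    rw [hlazy, ← wordAvg_const hS' n ((C + N) * (n : ℝ) ^ α)]
    exact wordAvg_mono fun w hw _ => hupper _ n hn (by rw [← hw]; exact List.countP_le_length)
  have hlow : ∀ n : ℕ, 4 * N + 1 ≤ n → c / 4 * (n : ℝ) ^ α ≤ walkMean (insert 1 S) n l := by
    intro n hn
    have hn0 : (0 : ℝ) < n := by exact_mod_cast (by omega)
    have h1 : wordAvg (insert 1 S) n (fun w => c * (n : ℝ) ^ (α - 1) *
        (w.countP (· ∈ S) - N)) ≤
        walkMean (insert 1 S) n l := by
      rw [hlazy]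
      exact wordAvg_mono fun w hw _ =>
        hlower _ n (by omega) (by rw [← hw]; exact List.countP_le_length)
    rw [wordAvg_const_mul, wordAvg_sub, wordAvg_const hS',
      wordAvg_countP hS' (Finset.subset_insert 1 S)] at h1
    refine le_trans ?_ h1
    -- At least half of the letters lie in `S`, so the mean of the random time minus `N` is at least
    -- `n/2 - N ≥ n/4`.
    have hcard : (1 / 2 : ℝ) ≤ S.card / (insert 1 S).card := by
      have h1 : ((insert 1 S).card : ℝ) ≤ S.card + 1 := by exact_mod_cast Finset.card_insert_le 1 S
      have h2 : (1 : ℝ) ≤ S.card := by exact_mod_cast hS.card_pos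
      rw [le_div_iff₀ (by exact_mod_cast hS'.card_pos)]
      linarith
    have h2 : (n : ℝ) ^ α = (n : ℝ) ^ (α - 1) * n := by
      rw [Real.rpow_sub_one hn0.ne']; field_simp
    have h3 : (4 * N + 1 : ℝ) ≤ n := by exact_mod_cast hn
    calc c / 4 * (n : ℝ) ^ α = c * (n : ℝ) ^ (α - 1) * (n / 4) := by rw [h2]; ring
      _ ≤ _ := by
        gcongr
        nlinarith
  have hpos := walkMean_insert_one_pos hinv hgen hs hs1
  -- Local times may be small, so the lower bound is needed from `m = 1` on; the finitely many small
  -- times use positivity.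
  have hsmall : ∀ K : ℕ, ∃ d > 0, ∀ n : ℕ, 1 ≤ n → n ≤ K →
      d * (n : ℝ) ^ α ≤ walkMean (insert 1 S) n l := by
    intro K
    induction K with
    | zero => exact ⟨1, one_pos, fun n h1 h2 => by omega⟩
    | succ K ih =>
      obtain ⟨d, hd, hd'⟩ := ih
      refine ⟨min d (walkMean (insert 1 S) (K + 1) l / ((K + 1 : ℕ) : ℝ) ^ α),
        lt_min hd (div_pos (hpos K) (by positivity)), fun n h1 h2 => ?_⟩
      rcases Nat.lt_or_ge n (K + 1) with h | h
      · exact le_trans (by gcongr; exact min_le_left _ _) (hd' n h1 (by omega))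
      · obtain rfl : n = K + 1 := by omega
        refine (mul_le_mul_of_nonneg_right (min_le_right _ _) (by positivity)).trans ?_
        rw [div_mul_cancel₀]
        positivity
  obtain ⟨d, hd, hd'⟩ := hsmall (4 * N + 1)
  refine ⟨min d (c / 4), lt_min hd (by positivity), C + N, by positivity,
    fun m hm => ⟨?_, hU m hm⟩⟩
  rcases le_total m (4 * N + 1) with h | h
  · exact le_trans (by gcongr; exact min_le_left _ _) (hd' m hm h)
  · exact le_trans (by gcongr; exact min_le_right _ _) (hlow m h)

end DriftBounds

/-! ### The drift on the wreath product. -/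

section WreathDrift

open Filter

/-- The first term dominates for `v ≤ r`, the second for `v ≥ r`. Summed over visited sites, they
involve only the range and the total local time. -/
theorem rpow_le_rpow_add_rpow_sub_one_mul {v r α : ℝ} (hv : 0 < v) (hr : 0 < r) (hα0 : 0 ≤ α)
    (hα1 : α ≤ 1) : v ^ α ≤ r ^ α + r ^ (α - 1) * v := by
  rcases le_total v r with h | h
  · exact (Real.rpow_le_rpow hv.le h hα0).trans (le_add_of_nonneg_right (by positivity))
  · have h1 : v ^ (α - 1) ≤ r ^ (α - 1) := Real.rpow_le_rpow_of_nonpos hr h (by linarith)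
    have h2 : v ^ α = v ^ (α - 1) * v := by rw [Real.rpow_sub_one hv.ne']; field_simp
    rw [h2]
    exact (mul_le_mul_of_nonneg_right h1 hv.le).trans (le_add_of_nonneg_left (by positivity))

/-- The left side is nonpositive for `v ≥ r`, and `v^α ≥ r^(α-1) v` below. First and second moments
of local time thus give a lower bound for `∑ v^α`. -/
theorem rpow_sub_one_mul_sub_le_rpow {v r α : ℝ} (hv : 0 < v) (hr : 0 < r) (hα1 : α ≤ 1) :
    r ^ (α - 1) * (v - v ^ 2 / r) ≤ v ^ α := by
  rcases le_total v r with h | h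
  · have h1 : r ^ (α - 1) ≤ v ^ (α - 1) := Real.rpow_le_rpow_of_nonpos hv h (by linarith)
    have h2 : v ^ α = v ^ (α - 1) * v := by rw [Real.rpow_sub_one hv.ne']; field_simp
    rw [h2]
    refine (mul_le_mul_of_nonneg_left (sub_le_self v (by positivity)) (by positivity)).trans ?_
    exact mul_le_mul_of_nonneg_right h1 hv.le
  · refine le_trans (mul_nonpos_of_nonneg_of_nonpos (by positivity) ?_) (by positivity)
    rw [sub_nonpos, le_div_iff₀ hr]
    nlinarith

theorem natCast_rpow_half_eq {n : ℕ} (α : ℝ) : (n : ℝ) ^ ((α + 1) / 2) = √n ^ (α + 1) := by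
  rw [Real.sqrt_eq_rpow, ← Real.rpow_mul (by positivity)]
  ring_nf

variable {A : Type*} [Group A] {S : Finset A}

theorem switchWalk_drift_ge (hinv : ∀ s ∈ S, s⁻¹ ∈ S) (h1 : (1 : A) ∈ S)
    (hS : Subgroup.closure (S : Set A) = ⊤) {l : A → ℕ} (hl1 : l 1 = 0)
    (hl : ∀ s ∈ S, ∀ x, l (s * x) ≤ 1 + l x) {α c : ℝ} (hα1 : α ≤ 1) (hc : 0 < c)
    (hL : ∀ m : ℕ, 1 ≤ m → c * (m : ℝ) ^ α ≤ walkMean S m fun g => (l g : ℝ)) {n : ℕ}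
    (hn : 1 ≤ n) :
    c * 14 ^ (α - 1) / 2 * (n : ℝ) ^ ((α + 1) / 2) ≤
      walkMean (switchGenerators S) n fun g =>
        (wordLength (switchGenerators S : Set (ZWreath A)) g : ℝ) := by
  have hSne : S.Nonempty := ⟨1, h1⟩
  have hT := switchTriples_nonempty hSne
  have hs : 1 ≤ √(n : ℝ) := Real.one_le_sqrt.2 (by exact_mod_cast hn)
  have hs2 : √(n : ℝ) ^ 2 = n := Real.sq_sqrt (by positivity)
  -- The constant is `14 = 8 + 6`: it makes `8√n + 6 ≤ r`, so the quadratic term costs at most half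
  -- of the total `2n`.
  set r : ℝ := 14 * √n with hr
  have hr0 : 0 < r := by positivity
  have hLv : ∀ v : ℕ, c * r ^ (α - 1) * (v - (v : ℝ) ^ 2 / r) ≤
      walkMean S v fun g => (l g : ℝ) := by
    intro v
    rcases Nat.eq_zero_or_pos v with rfl | hv
    · simp [walkMean_zero, hl1]
    · refine le_trans ?_ (hL v hv)
      rw [mul_assoc]
      exact mul_le_mul_of_nonneg_left
        (rpow_sub_one_mul_sub_le_rpow (by exact_mod_cast hv) hr0 hα1) hc.le
  -- A fixed window that contains every path of length `n`, so that the sum over sites commutes with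
  -- the average.
  set F : Finset ℤ := Finset.Icc (-n : ℤ) n with hF
  have hlamps : wordAvg (switchTriples S) n (fun w => ∑ x ∈ F, walkMean S (visits w x)
      fun g => (l g : ℝ)) ≤ 2 * walkMean (switchGenerators S) n fun g =>
        (wordLength (switchGenerators S : Set (ZWreath A)) g : ℝ) := by
    rw [wordAvg_finset_sum]
    simp only [← wordAvg_lamp hSne]
    rw [← wordAvg_finset_sum, walkMean_switchGenerators, ← wordAvg_const_mul]
    refine wordAvg_mono fun w _ _ => ?_
    exact_mod_cast sum_lamps_le_wordLength hinv h1 hS hl1 hl _ F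
  have hpath : wordAvg (switchTriples S) n
      (fun w => c * r ^ (α - 1) * (2 * n - r⁻¹ * visitsSq w)) ≤
      wordAvg (switchTriples S) n (fun w => ∑ x ∈ F, walkMean S (visits w x)
        fun g => (l g : ℝ)) := by
    refine wordAvg_mono fun w hw hw' => ?_
    refine le_trans ?_ (Finset.sum_le_sum fun x _ => hLv (visits w x))
    rw [← Finset.mul_sum, Finset.sum_sub_distrib, ← Finset.sum_div]
    have e1 : ∑ x ∈ F, (visits w x : ℝ) = 2 * n := by
      rw [← hw]
      refine (hasSum_sum_of_ne_finset_zero fun x hx => ?_).unique (hasSum_visits w)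
      have h2 := reach_le_length hw' (σ := 1) (by simp)
      have h3 := reach_le_length hw' (σ := -1) (by simp)
      rw [hF, Finset.mem_Icc] at hx
      rw [visits_eq_zero (by omega), Nat.cast_zero]
    have e2 : ∑ x ∈ F, (visits w x : ℝ) ^ 2 ≤ visitsSq w :=
      sum_le_hasSum F (fun x _ => by positivity) (hasSum_visits_sq hw')
    rw [e1, div_eq_inv_mul]
    gcongr
  have hsq := wordAvg_visitsSq_le hSne n
  rw [wordAvg_const_mul, wordAvg_sub, wordAvg_const hT, wordAvg_const_mul] at hpath
  have hmain : (n : ℝ) ≤ 2 * n - r⁻¹ * wordAvg (switchTriples S) n visitsSq := by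
    have : r⁻¹ * wordAvg (switchTriples S) n visitsSq ≤ n := by
      rw [inv_mul_le_iff₀ hr0]
      refine hsq.trans ?_
      rw [mul_comm]
      gcongr
      linarith
    linarith
  have hpow : c * 14 ^ (α - 1) / 2 * (n : ℝ) ^ ((α + 1) / 2) * 2 = c * r ^ (α - 1) * n := by
    rw [natCast_rpow_half_eq, hr, Real.mul_rpow (by norm_num) (by positivity),
      show α + 1 = (α - 1) + 2 by ring, Real.rpow_add (by positivity), Real.rpow_two, hs2]
    ring_nf
  have := mul_le_mul_of_nonneg_left hmain (a := c * r ^ (α - 1)) (by positivity)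
  linarith

theorem switchWalk_drift_le (hinv : ∀ s ∈ S, s⁻¹ ∈ S) (h1 : (1 : A) ∈ S) {l : A → ℕ}
    (hl1 : l 1 = 0) (hl : ∀ x, HasWord (S : Set A) (l x) x) {α C : ℝ} (hα0 : 0 ≤ α) (hα1 : α ≤ 1)
    (hC : 0 < C) (hL : ∀ m : ℕ, 1 ≤ m → walkMean S m (fun g => (l g : ℝ)) ≤ C * (m : ℝ) ^ α)
    {n : ℕ} (hn : 1 ≤ n) :
    walkMean (switchGenerators S) n (fun g =>
        (wordLength (switchGenerators S : Set (ZWreath A)) g : ℝ)) ≤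
      (8 + 10 * C) * (n : ℝ) ^ ((α + 1) / 2) := by
  have hSne : S.Nonempty := ⟨1, h1⟩
  have hT := switchTriples_nonempty hSne
  have hs2 : √(n : ℝ) ^ 2 = n := Real.sq_sqrt (by positivity)
  set r : ℝ := √n with hr
  have hr1 : 1 ≤ r := Real.one_le_sqrt.2 (by exact_mod_cast hn)
  have hr0 : 0 < r := by positivity
  -- The indicator discards unvisited sites, so the sum of `r^α` is controlled by the range.
  have hLv : ∀ v : ℕ, walkMean S v (fun g => (l g : ℝ)) ≤
      C * (r ^ α * (if v = 0 then 0 else 1) + r ^ (α - 1) * v) := by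
    intro v
    rcases Nat.eq_zero_or_pos v with rfl | hv
    · simp [walkMean_zero, hl1]
    · refine (hL v hv).trans ?_
      rw [if_neg hv.ne', mul_one]
      exact mul_le_mul_of_nonneg_left
        (rpow_le_rpow_add_rpow_sub_one_mul (by exact_mod_cast hv) hr0 hα0 hα1) hC.le
  set F : Finset ℤ := Finset.Icc (-n : ℤ) n with hF
  have hlength : walkMean (switchGenerators S) n (fun g =>
      (wordLength (switchGenerators S : Set (ZWreath A)) g : ℝ)) ≤
      wordAvg (switchTriples S) n (fun w => 3 * ((reach (-1) w : ℝ) + reach 1 w) + 2 +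
        2 * ∑ x ∈ F, (l ((w.map switchStep).prod.left.1 x) : ℝ)) := by
    rw [walkMean_switchGenerators]
    refine wordAvg_mono fun w hw hw' => (wordLength_switchStep_le hinv h1 hl w).trans ?_
    gcongr
    have h2 := reach_le_length hw' (σ := 1) (by simp)
    have h3 := reach_le_length hw' (σ := -1) (by simp)
    exact Finset.Icc_subset_Icc (by omega) (by omega)
  have hpath : wordAvg (switchTriples S) n (fun w => ∑ x ∈ F, walkMean S (visits w x)
      fun g => (l g : ℝ)) ≤ wordAvg (switchTriples S) n
        (fun w => C * (r ^ α * ((reach (-1) w : ℝ) + reach 1 w + 1) + r ^ (α - 1) * (2 * n))) := by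
    refine wordAvg_mono fun w hw hw' => ?_
    refine (Finset.sum_le_sum fun x _ => hLv (visits w x)).trans ?_
    rw [← Finset.mul_sum, Finset.sum_add_distrib, ← Finset.mul_sum, ← Finset.mul_sum]
    have e1 : ∑ x ∈ F, (visits w x : ℝ) ≤ 2 * n := by
      rw [← hw]
      exact sum_le_hasSum F (fun x _ => by positivity) (hasSum_visits w)
    have e2 : ∑ x ∈ F, (if visits w x = 0 then 0 else 1 : ℝ) ≤
        (reach (-1) w : ℝ) + reach 1 w + 1 := by
      have h2 := reach_nonneg 1 w
      have h3 := reach_nonneg (-1) w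
      calc ∑ x ∈ F, (if visits w x = 0 then 0 else 1 : ℝ)
          ≤ ∑ x ∈ F, (if x ∈ Finset.Icc (-reach (-1) w) (reach 1 w) then 1 else 0 : ℝ) := by
            refine Finset.sum_le_sum fun x _ => ?_
            by_cases hx : x ∈ Finset.Icc (-reach (-1) w) (reach 1 w)
            · rw [if_pos hx]; split_ifs <;> norm_num
            · rw [if_neg hx, if_pos]
              rw [Finset.mem_Icc] at hx
              exact visits_eq_zero (by omega)
        _ ≤ ((Finset.Icc (-reach (-1) w) (reach 1 w)).card : ℝ) := by
            rw [Finset.sum_ite_mem, Finset.sum_const, nsmul_one]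
            exact_mod_cast Finset.card_le_card Finset.inter_subset_right
        _ = _ := by
            have : ((Finset.Icc (-reach (-1) w) (reach 1 w)).card : ℤ) =
                reach (-1) w + reach 1 w + 1 := by
              rw [Int.card_Icc]; omega
            exact_mod_cast this
    gcongr
  have hlamps : wordAvg (switchTriples S) n (fun w => ∑ x ∈ F, walkMean S (visits w x)
      fun g => (l g : ℝ)) = wordAvg (switchTriples S) n
        (fun w => ∑ x ∈ F, (l ((w.map switchStep).prod.left.1 x) : ℝ)) := by
    rw [wordAvg_finset_sum, wordAvg_finset_sum]
    exact Finset.sum_congr rfl fun x _ =>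
      (wordAvg_lamp hSne n x fun g => (l g : ℝ)).symm
  have hm := wordAvg_reach_le hSne (σ := -1) (by simp) n
  have hM := wordAvg_reach_le hSne (σ := 1) (by simp) n
  simp only [wordAvg_add, wordAvg_const hT, wordAvg_const_mul] at hlength hpath
  rw [← hlamps] at hlength
  set ρ := wordAvg (switchTriples S) n (fun w => (reach (-1) w : ℝ)) +
    wordAvg (switchTriples S) n (fun w => (reach 1 w : ℝ)) with hρ
  have hρr : ρ ≤ 2 * r := by linarith
  have hpow1 : r ^ (α - 1) * n = r ^ (α + 1) := by
    rw [← hs2, ← Real.rpow_two, ← Real.rpow_add hr0]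
    ring_nf
  have hpow2 : r ^ α * r = r ^ (α + 1) := by rw [Real.rpow_add_one hr0.ne']
  have hpow3 : r ^ α ≤ r ^ (α + 1) := Real.rpow_le_rpow_of_exponent_le hr1 (by linarith)
  have hpow4 : r ≤ r ^ (α + 1) := by
    simpa using Real.rpow_le_rpow_of_exponent_le hr1 (show (1 : ℝ) ≤ α + 1 by linarith)
  -- Here `5 = (2 + 1) + 2`. In the final constant, `8` bounds `3ρ + 2 ≤ 6r + 2` and `10 C` is twice
  -- `5 C`.
  have hfinal : C * (r ^ α * (ρ + 1) + r ^ (α - 1) * (2 * n)) ≤ C * (5 * r ^ (α + 1)) := by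
    have : r ^ α * (ρ + 1) ≤ r ^ α * (2 * r + 1) := by gcongr
    gcongr
    linarith
  rw [natCast_rpow_half_eq, ← hr]
  linarith

theorem isTheta_of_forall_bounds {c C β : ℝ} (hc : 0 < c) {L : ℕ → ℝ}
    (h : ∀ n : ℕ, 1 ≤ n → c * (n : ℝ) ^ β ≤ L n ∧ L n ≤ C * (n : ℝ) ^ β) :
    Asymptotics.IsTheta atTop L fun n : ℕ => (n : ℝ) ^ β := by
  have key : ∀ n : ℕ, 1 ≤ n → ‖(n : ℝ) ^ β‖ = (n : ℝ) ^ β ∧ ‖L n‖ = L n := fun n hn => by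
    have h0 : 0 ≤ (n : ℝ) ^ β := by positivity
    exact ⟨Real.norm_of_nonneg h0,
      Real.norm_of_nonneg ((mul_nonneg hc.le h0).trans (h n hn).1)⟩
  constructor
  · refine Asymptotics.IsBigO.of_bound C ?_
    filter_upwards [eventually_ge_atTop 1] with n hn
    rw [(key n hn).1, (key n hn).2]
    exact (h n hn).2
  · refine Asymptotics.IsBigO.of_bound c⁻¹ ?_
    filter_upwards [eventually_ge_atTop 1] with n hn
    rw [(key n hn).1, (key n hn).2, ← div_eq_inv_mul, le_div_iff₀' hc]
    exact (h n hn).1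

theorem withInverses_inv_mem {k : ℕ} (a : Fin k → A) {g : A} (hg : g ∈ withInverses a) :
    g⁻¹ ∈ withInverses a := by
  classical
  simp only [withInverses, Finset.mem_union, Finset.mem_image, Finset.mem_univ, true_and] at hg ⊢
  rcases hg with ⟨i, rfl⟩ | ⟨i, rfl⟩
  exacts [Or.inr ⟨i, rfl⟩, Or.inl ⟨i, (inv_inv _).symm⟩]

open Classical in
theorem exists_zpow_eq_iff {k : ℕ} [NeZero k] (a : Fin k → A) (x : A) :
    x ∈ insert 1 (withInverses a) ↔ ∃ i, ∃ p ∈ ({0, 1, -1} : Set ℤ), a i ^ p = x := by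
  simp only [withInverses, Finset.mem_insert, Finset.mem_union, Finset.mem_image,
    Finset.mem_univ, true_and]
  constructor
  · rintro (rfl | ⟨i, rfl⟩ | ⟨i, rfl⟩)
    exacts [⟨0, 0, by simp⟩, ⟨i, 1, by simp⟩, ⟨i, -1, by simp⟩]
  · rintro ⟨i, p, rfl | rfl | rfl, rfl⟩
    exacts [by simp, by simp, by simp]

open Classical in
-- The exponent `0` supplies the letter `1`, and inversion supplies the triples with `ε = -1`.
theorem mem_switchGenerators_insert_one {k : ℕ} [NeZero k] (a : Fin k → A) (g : ZWreath A) :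
    g ∈ switchGenerators (insert 1 (withInverses a)) ↔
      g ∈ switchWalkSwitch a ∨ g⁻¹ ∈ switchWalkSwitch a := by
  have hpos : ∀ g, g ∈ switchWalkSwitch a ↔ ∃ x ∈ insert 1 (withInverses a),
      ∃ y ∈ insert 1 (withInverses a), switchStep (x, 1, y) = g := by
    intro g
    constructor
    · rintro ⟨i, j, p, hp, q, hq, rfl⟩
      refine ⟨_, (exists_zpow_eq_iff a _).2 ⟨i, p, hp, rfl⟩, _,
        (exists_zpow_eq_iff a _).2 ⟨j, q, hq, rfl⟩, ?_⟩
      simp [switchStep, lamp_zpow]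
    · rintro ⟨x, hx, y, hy, rfl⟩
      obtain ⟨i, p, hp, rfl⟩ := (exists_zpow_eq_iff a _).1 hx
      obtain ⟨j, q, hq, rfl⟩ := (exists_zpow_eq_iff a _).1 hy
      exact ⟨i, j, p, hp, q, hq, by simp [switchStep, lamp_zpow]⟩
  have hinv : ∀ x ∈ insert 1 (withInverses a), x⁻¹ ∈ insert 1 (withInverses a) := by
    intro x hx
    rcases Finset.mem_insert.1 hx with rfl | hx
    · simp
    · exact Finset.mem_insert_of_mem (withInverses_inv_mem a hx)
  rw [mem_switchGenerators, hpos, hpos]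
  constructor
  · rintro ⟨⟨x, e, y⟩, ht, rfl⟩
    obtain ⟨hx, rfl | rfl, hy⟩ := mem_switchTriples.1 ht
    · exact Or.inl ⟨x, hx, y, hy, rfl⟩
    · exact Or.inr ⟨y⁻¹, hinv y hy, x⁻¹, hinv x hx, by simp [switchStep_inv]⟩
  · rintro (⟨x, hx, y, hy, rfl⟩ | ⟨x, hx, y, hy, h⟩)
    · exact ⟨(x, 1, y), by simp only [mem_switchTriples]; tauto, rfl⟩
    · refine ⟨(y⁻¹, -1, x⁻¹), ?_, ?_⟩
      · exact mem_switchTriples.2 ⟨hinv y hy, Or.inr rfl, hinv x hx⟩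
      · rw [← inv_inv g, ← h, switchStep_inv]

end WreathDrift

theorem lemma3 {A : Type*} [Group A] (k : ℕ) [NeZero k] (a : Fin k → A)
    (ha : Subgroup.closure (Set.range a) = ⊤) (α : ℝ)
    (hα : Asymptotics.IsTheta Filter.atTop
      (simpleDrift (withInverses a) (withInverses_nonempty a))
      (fun n : ℕ => (n : ℝ) ^ α)) :
    ∃ (T : Finset (ZWreath A)) (hT : T.Nonempty),
      (∀ g : ZWreath A, g ∈ T ↔ g ∈ switchWalkSwitch a ∨ g⁻¹ ∈ switchWalkSwitch a) ∧
      IsSymmGenerating T ∧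
      Asymptotics.IsTheta Filter.atTop (simpleDrift T hT)
        (fun n : ℕ => (n : ℝ) ^ ((α + 1) / 2)) := by
  classical
  set S := withInverses a with hSdef
  have hinv : ∀ g ∈ S, g⁻¹ ∈ S := fun g => withInverses_inv_mem a
  have hgen : Subgroup.closure (S : Set A) = ⊤ := by
    rw [eq_top_iff, ← ha]
    refine Subgroup.closure_mono ?_
    rintro _ ⟨i, rfl⟩
    simp [hSdef, withInverses]
  have hinv' : ∀ g ∈ insert 1 S, g⁻¹ ∈ insert 1 S := by
    intro g hg
    rcases Finset.mem_insert.1 hg with rfl | hg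
    · simp
    · exact Finset.mem_insert_of_mem (hinv g hg)
  have hgen' : Subgroup.closure ((insert 1 S : Finset A) : Set A) = ⊤ := by
    rw [eq_top_iff, ← hgen]
    exact Subgroup.closure_mono (by simp)
  have h1 : (1 : A) ∈ insert 1 S := by simp
  have hl1 : wordLength (S : Set A) 1 = 0 := wordLength_one
  have hl : ∀ s ∈ insert 1 S, ∀ x, wordLength (S : Set A) (s * x) ≤
      1 + wordLength (S : Set A) x := by
    intro s hs x
    refine (wordLength_mul_le hinv hgen s x).trans (Nat.add_le_add_right ?_ _)
    rcases Finset.mem_insert.1 hs with rfl | hs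
    · simp [hl1]
    · exact (HasWord.of_mem (S := (S : Set A)) hs).wordLength_le
  -- Lamp lengths are measured with `S` although the switches use `insert 1 S`; adding the letter
  -- `1` preserves all bounds used.
  have hword : ∀ x, HasWord ((insert 1 S : Finset A) : Set A) (wordLength (S : Set A) x) x := by
    intro x
    obtain ⟨w, hw, hw', h⟩ := hasWord_wordLength (S := (S : Set A)) hinv hgen x
    exact ⟨w, hw, fun y hy => by simpa using Or.inr (hw' y hy), h⟩
  obtain ⟨hα0, hα1, c, hc, C, hC, hbounds⟩ :=
    lazy_drift_bounds (withInverses_nonempty a) hinv hgen hα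
  have hT : (switchGenerators (insert 1 S)).Nonempty :=
    (switchTriples_nonempty ⟨1, h1⟩).image _
  refine ⟨switchGenerators (insert 1 S), hT, mem_switchGenerators_insert_one a,
    ⟨fun g => switchGenerators_inv_mem hinv', closure_switchGenerators hinv' h1 hgen'⟩, ?_⟩
  refine isTheta_of_forall_bounds (c := c * 14 ^ (α - 1) / 2) (C := 8 + 10 * C) (by positivity)
    fun n hn => ?_
  rw [simpleDrift_eq_walkMean]
  exact ⟨switchWalk_drift_ge hinv' h1 hgen' hl1 hl hα1 hc (fun m hm => (hbounds m hm).1) hn,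
    switchWalk_drift_le hinv' h1 hl1 hword hα0 hα1 hC (fun m hm => (hbounds m hm).2) hn⟩
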